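/- Let $N\ge 1$, $s\in(0,1)$, $2\le p<\infty$ with $N>sp$, and let $\Omega\subset\mathbb R^N$ be a nonempty bounded open set (for instance a bounded domain with Lipschitz boundary). Put $$[u]_{s,p}^p=\int_{\mathbb R^N}\!\int_{\mathbb R^N}\frac{|u(x)-u(y)|^p}{|x-y|^{N+sp}}\,dy\,dx,\qquad \|u\|_p^p=\int_\Omega|u|^p\,dx,$$ let $W_0^{s,p}(\Omega)$ be the space of all $u\in L^p(\mathbb R^N)$ with $[u]_{s,p}<\infty$ and $u=0$ a.e. in $\mathbb R^N\setminus\Omega$, and let $X_0=W_0^{s,p}(\Omega)\setminus\{0\}$. For $u\in W_0^{s,p}(\Omega)$ define (with $|u|^p\log|u|=0$ where $u=0$) $$E(u)=\frac1p[u]_{s,p}^p+\frac1p\|u\|_p^p-\frac1p\int_\Omega|u|^p\log|u|\,dx+\frac1{p^2}\|u\|_p^p,$$ $$I(u)=[u]_{s,p}^p+\|u\|_p^p-\int_\Omega|u|^p\log|u|\,dx,$$ and let $\mathcal N=\{u\in X_0: I(u)=0\}$ and $d=\inf_{u\in\mathcal N}E(u)$. Then the following hold. 1. $\displaystyle d=\inf_{u\in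 X_0}\ \sup_{\lambda>0}E(\lambda u).$ 2. Let $0<\varrho<\frac{sp^2}{N}$, let $\theta$ be given by $\frac1{p+\varrho}=\frac{1-\theta}{p}+\frac{\theta}{p_s^*}$ with $p_s^*=\frac{Np}{N-sp}$, and let $\gamma=\frac{(1-\theta)(p+\varrho)}{p-\theta(p+\varrho)}$. There is a constant $C>0$ such that $$\int_\Omega|u|^p\log|u|\,dx\le\frac12[u]_{s,p}^p+C\big(\|u\|_p^p\big)^{\gamma}\qquad\text{for all }u\in X_0,$$ and for every such $C$, with $R=(1/C)^{\frac1{p(\gamma-1)}}$, $$d\ge M:=\frac{R^p}{p^2}>0.$$ 3. There is $u\in\mathcal N$ with $E(u)=d$ which is a critical point of $E$, that is, $\frac{d}{dt}E(u+tv)\big|_{t=0}=0$ for all $v\in W_0^{s,p}(\Omega)$, and which is a ground state of the stationary problem $(-\Delta)_p^su+|u|^{p-2}u=|u|^{p-2}u\log|u|$ in $\Omega$, $u=0$ in $\mathbb R^N\setminus\Omega$. This means that for all $v\in W_0^{s,p}(\Omega)$ $$\int_{\mathbb R^N}\!\int_{\mathbb R^N}\frac{|u(x)-u(y)|^{p-2}(u(x)-u(y))(v(x)-v(y))}{|x-y|^{N+sp}}\,dy\,dx+\int_\Omega|u|^{p-2}uv\,dx=\int_\Omega|u|^{p-2}u\log|u|\,v\,dx,$$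 and that $E(u)\le E(w)$ for every $w\in X_0$ that satisfies the same identity for all $v\in W_0^{s,p}(\Omega)$. -/

import Mathlib

open MeasureTheory

noncomputable section

namespace FracLog

/-- The `p`-th power `[u]_{s,p}^p` of the Gagliardo seminorm, as an extended nonnegative number:
the double integral over `ℝ^N × ℝ^N` of `|u x - u y|^p / |x - y|^(N + s p)`. -/
def gagliardoPow (N : ℕ) (s p : ℝ) (u : EuclideanSpace ℝ (Fin N) → ℝ) : ENNReal :=
  ∫⁻ x, ∫⁻ y, ENNReal.ofReal (|u x - u y| ^ p / ‖x - y‖ ^ ((N : ℝ) + s * p))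

/-- The space `W_0^{s,p}(Ω)`: functions on `ℝ^N` that vanish almost everywhere outside `Ω`, lie in
`L^p`, and have finite Gagliardo seminorm. Functions that agree almost everywhere represent the
same element; every notion below is invariant under such a change. -/
def W0 {N : ℕ} (Ω : Set (EuclideanSpace ℝ (Fin N))) (s p : ℝ) :
    Set (EuclideanSpace ℝ (Fin N) → ℝ) :=
  {u | MemLp u (ENNReal.ofReal p) volume ∧ gagliardoPow N s p u < ⊤ ∧
    ∀ᵐ x ∂(volume : Measure (EuclideanSpace ℝ (Fin N))), x ∉ Ω → u x = 0}

/-- `X_0 = W_0^{s,p}(Ω) \ {0}`. -/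
def X0 {N : ℕ} (Ω : Set (EuclideanSpace ℝ (Fin N))) (s p : ℝ) :
    Set (EuclideanSpace ℝ (Fin N) → ℝ) :=
  {u | u ∈ W0 Ω s p ∧ ¬ (∀ᵐ x ∂(volume : Measure (EuclideanSpace ℝ (Fin N))), u x = 0)}

/-- `‖u‖_p^p`, the integral of `|u|^p` over `Ω`. -/
def normPow {N : ℕ} (Ω : Set (EuclideanSpace ℝ (Fin N))) (p : ℝ)
    (u : EuclideanSpace ℝ (Fin N) → ℝ) : ℝ :=
  ∫ x in Ω, |u x| ^ p

/-- The integral of `|u|^p log |u|` over `Ω` (the integrand is `0` where `u = 0`). -/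
def logTerm {N : ℕ} (Ω : Set (EuclideanSpace ℝ (Fin N))) (p : ℝ)
    (u : EuclideanSpace ℝ (Fin N) → ℝ) : ℝ :=
  ∫ x in Ω, |u x| ^ p * Real.log |u x|

/-- The energy functional `E`. -/
def energy {N : ℕ} (Ω : Set (EuclideanSpace ℝ (Fin N))) (s p : ℝ)
    (u : EuclideanSpace ℝ (Fin N) → ℝ) : ℝ :=
  1 / p * (gagliardoPow N s p u).toReal + 1 / p * normPow Ω p u - 1 / p * logTerm Ω p u
    + 1 / p ^ 2 * normPow Ω p u

/-- The Nehari functional `I`. -/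
def nehariFunctional {N : ℕ} (Ω : Set (EuclideanSpace ℝ (Fin N))) (s p : ℝ)
    (u : EuclideanSpace ℝ (Fin N) → ℝ) : ℝ :=
  (gagliardoPow N s p u).toReal + normPow Ω p u - logTerm Ω p u

/-- The Nehari manifold: all `u ∈ X_0` with `I(u) = 0`. -/
def nehari {N : ℕ} (Ω : Set (EuclideanSpace ℝ (Fin N))) (s p : ℝ) :
    Set (EuclideanSpace ℝ (Fin N) → ℝ) :=
  {u | u ∈ X0 Ω s p ∧ nehariFunctional Ω s p u = 0}

/-- The depth `d` of the potential well, the infimum of `E` over the Nehari manifold. It is taken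
in the extended reals, so that no convention for empty or unbounded sets enters. -/
def depth {N : ℕ} (Ω : Set (EuclideanSpace ℝ (Fin N))) (s p : ℝ) : EReal :=
  ⨅ u ∈ nehari Ω s p, (energy Ω s p u : EReal)

/-- The constant `C > 0` is admissible for the logarithmic estimate with parameters `ε` and `γ`:
`∫_Ω |u|^p log |u| ≤ ε [u]_{s,p}^p + C (‖u‖_p^p)^γ` for all `u ∈ X_0`. -/
def LogEstimate {N : ℕ} (Ω : Set (EuclideanSpace ℝ (Fin N))) (s p ε γ C : ℝ) : Prop :=
  0 < C ∧ ∀ u ∈ X0 Ω s p,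
    logTerm Ω p u ≤ ε * (gagliardoPow N s p u).toReal + C * normPow Ω p u ^ γ

/-- The radius `R = (1 / C)^(1 / (p (γ - 1)))`. -/
def radius (p γ C : ℝ) : ℝ := (1 / C) ^ (1 / (p * (γ - 1)))

/-- The form `K^{s,p}(u, v)`, the weak form of the fractional `p`-Laplacian. -/
def formK (N : ℕ) (s p : ℝ) (u v : EuclideanSpace ℝ (Fin N) → ℝ) : ℝ :=
  ∫ x, ∫ y, |u x - u y| ^ (p - 2) * (u x - u y) / ‖x - y‖ ^ ((N : ℝ) + s * p) * (v x - v y)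

/-- `u` is a critical point of `E`: the directional derivative of `E` at `u` exists and vanishes
in every direction `v ∈ W_0^{s,p}(Ω)`. -/
def IsCriticalPoint {N : ℕ} (Ω : Set (EuclideanSpace ℝ (Fin N))) (s p : ℝ)
    (u : EuclideanSpace ℝ (Fin N) → ℝ) : Prop :=
  u ∈ W0 Ω s p ∧
    ∀ v ∈ W0 Ω s p, HasDerivAt (fun t : ℝ => energy Ω s p (u + t • v)) 0 0

/-- `u` is a weak solution of the stationary problem
`(-Δ)_p^s u + |u|^(p-2) u = |u|^(p-2) u log |u|` in `Ω`, `u = 0` outside `Ω`. -/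
def IsStationarySolution {N : ℕ} (Ω : Set (EuclideanSpace ℝ (Fin N))) (s p : ℝ)
    (u : EuclideanSpace ℝ (Fin N) → ℝ) : Prop :=
  u ∈ W0 Ω s p ∧ ∀ v ∈ W0 Ω s p,
    formK N s p u v + ∫ x in Ω, |u x| ^ (p - 2) * u x * v x
      = ∫ x in Ω, |u x| ^ (p - 2) * u x * Real.log |u x| * v x

/-- A ground state: a nontrivial weak solution of the stationary problem whose energy is least
among all nontrivial weak solutions. -/
def IsGroundState {N : ℕ} (Ω : Set (EuclideanSpace ℝ (Fin N))) (s p : ℝ)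
    (u : EuclideanSpace ℝ (Fin N) → ℝ) : Prop :=
  u ∈ X0 Ω s p ∧ IsStationarySolution Ω s p u ∧
    ∀ w ∈ X0 Ω s p, IsStationarySolution Ω s p w → energy Ω s p u ≤ energy Ω s p w

end FracLog

end

/-! Write `m(u)` for `normPow`. For `l > 0` the logarithm gives `I(lu) = l^p (I(u) - m(u) log l)`,
and always `E = I/p + m/p²`. Hence every ray in `X0` meets the Nehari manifold exactly at `l =
exp(I(u)/m(u))`, where `E` is maximal along the ray with value `rayMax u = m exp(p I/m) / p²`. This
gives the minimax formula and turns `d` into an unconstrained infimum of a scale-invariant function.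
On the sphere `m = 1`, minimizing `rayMax` means minimizing `I`.

The analytic input is `exists_gagliardo_nirenberg`, `∫|u|^(p + sp²/N) ≤ c m^(sp/N) [u]^p`. Since
`log` grows more slowly than any power, it yields on the sphere `∫|u|^p log|u| ≤ [u]^p/2 + C`.
Rescaling produces the estimate with exponent `γ` and thus the lower bound for `d`. It also makes
`I` coercive on the sphere. A minimizing sequence converges in `L^p` and almost everywhere along a
subsequence (`exists_subseq_tendsto`), and Fatou's lemma handles both the seminorm and the
logarithmic term.

No Lagrange multiplier is needed: the minimizer `u` on the Nehari manifold minimizes `rayMax` over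
`X0`, and it also minimizes `rayMax - E ≥ 0`, which vanishes at `u`. Both directional derivatives
vanish, hence so does that of `E`. A nontrivial solution tested with itself lies on the Nehari
manifold, so `u` is a ground state. -/

namespace FracLog

open MeasureTheory Filter Topology

/-! ### Elementary inequalities for powers and logarithms -/

section Scalar

theorem abs_add_rpow_le (a b : ℝ) {p : ℝ} (hp : 1 ≤ p) :
    |a + b| ^ p ≤ 2 ^ (p - 1) * (|a| ^ p + |b| ^ p) := by
  have h := NNReal.rpow_add_le_mul_rpow_add_rpow ⟨|a|, abs_nonneg a⟩ ⟨|b|, abs_nonneg b⟩ hp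
  have h' : (|a| + |b|) ^ p ≤ 2 ^ (p - 1) * (|a| ^ p + |b| ^ p) := by exact_mod_cast h
  exact (Real.rpow_le_rpow (abs_nonneg _) (abs_add_le a b) (by linarith)).trans h'

/-- The logarithm is bounded by an arbitrarily small multiple of any positive power. -/
theorem exists_log_le_rpow {κ η : ℝ} (hκ : 0 < κ) (hη : 0 < η) :
    ∃ C : ℝ, 0 < C ∧ ∀ t : ℝ, 0 < t → Real.log t ≤ η * t ^ κ + C := by
  -- Apply `log x ≤ x - 1` at `x = κ η t^κ` and divide by `κ`; the summand `1` makes the constant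
  -- positive.
  refine ⟨|Real.log (κ * η)| / κ + 1, by positivity, fun t ht => ?_⟩
  have h1 : Real.log (κ * η * t ^ κ) ≤ κ * η * t ^ κ :=
    (Real.log_le_sub_one_of_pos (by positivity)).trans (by linarith)
  rw [Real.log_mul (by positivity) (by positivity), Real.log_rpow ht] at h1
  have h2 := neg_abs_le (Real.log (κ * η))
  have h3 : κ * Real.log t ≤ κ * (η * t ^ κ + |Real.log (κ * η)| / κ) := by
    have : κ * (|Real.log (κ * η)| / κ) = |Real.log (κ * η)| := by field_simp
    rw [mul_add, this]; linarith
  have := le_of_mul_le_mul_left h3 hκ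
  linarith

/-- The factor `η` is free, so the higher power can later be absorbed by the Gagliardo seminorm. -/
theorem exists_rpow_mul_log_le {p κ η : ℝ} (hp : 0 < p) (hκ : 0 < κ) (hη : 0 < η) :
    ∃ C : ℝ, 0 < C ∧ ∀ t : ℝ, |t| ^ p * Real.log |t| ≤ η * |t| ^ (p + κ) + C * |t| ^ p := by
  obtain ⟨C, hC, h⟩ := exists_log_le_rpow hκ hη
  refine ⟨C, hC, fun t => ?_⟩
  rcases (abs_nonneg t).eq_or_lt with h0 | h0
  · rw [← h0, Real.zero_rpow hp.ne', Real.zero_rpow (by positivity)]; simp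
  · rw [Real.rpow_add h0]
    have := mul_le_mul_of_nonneg_left (h _ h0) (Real.rpow_nonneg h0.le p)
    linarith

/-- `t ^ r |log t|` is at most `1 + t ^ (r + κ) / κ` when `r ≥ 1`. -/
theorem rpow_mul_abs_log_le {r κ : ℝ} (hr : 1 ≤ r) (hκ : 0 < κ) {t : ℝ} (ht : 0 ≤ t) :
    t ^ r * |Real.log t| ≤ 1 + t ^ (r + κ) / κ := by
  rcases ht.eq_or_lt with h0 | h0
  · rw [← h0]; simp; positivity
  -- Below `1` use `t |log t| < 1`; above `1` use `log t ≤ t^κ / κ`.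
  rcases le_total t 1 with h1 | h1
  · have h2 := Real.abs_log_mul_self_lt t h0 h1
    rw [abs_mul, abs_of_pos h0] at h2
    have h3 : t ^ r ≤ t := by
      simpa using Real.rpow_le_rpow_of_exponent_ge h0 h1 hr
    have h4 : t ^ r * |Real.log t| ≤ t * |Real.log t| := by gcongr
    have : 0 ≤ t ^ (r + κ) / κ := by positivity
    linarith
  · rw [abs_of_nonneg (Real.log_nonneg h1), Real.rpow_add h0]
    have := mul_le_mul_of_nonneg_left (Real.log_le_rpow_div ht hκ) (Real.rpow_nonneg ht r)
    have e : t ^ r * t ^ κ / κ = t ^ r * (t ^ κ / κ) := by ring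
    rw [e]; linarith

theorem hasDerivAt_abs_rpow_mul_log (x : ℝ) {p : ℝ} (hp : 2 ≤ p) :
    HasDerivAt (fun x => |x| ^ p * Real.log |x|)
      (p * |x| ^ (p - 2) * x * Real.log |x| + |x| ^ (p - 2) * x) x := by
  by_cases hx : x = 0
  -- At the origin the function is `x` times a continuous function vanishing there, which is its
  -- difference quotient. The stated formula also gives `0`.
  · subst hx
    simp only [mul_zero, zero_mul, add_zero]
    have hc : Continuous fun x : ℝ => |x| ^ (p - 2) * (x * Real.log x) :=
      (continuous_abs.rpow_const fun _ => Or.inr (by linarith)).mul Real.continuous_mul_log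
    have hd : HasDerivAt (fun x : ℝ => x * (|x| ^ (p - 2) * (x * Real.log x))) 0 0 := by
      rw [hasDerivAt_iff_tendsto_slope]
      have h1 := (hc.tendsto 0).mono_left (nhdsWithin_le_nhds (s := {0}ᶜ))
      simp only [zero_mul, mul_zero] at h1
      refine h1.congr' ?_
      filter_upwards [self_mem_nhdsWithin] with y hy
      have hy : y ≠ 0 := hy
      simp [slope, hy]
    refine hd.congr_of_eventuallyEq (Eventually.of_forall fun y => ?_)
    simp only [Real.log_abs]
    by_cases hy : y = 0
    · simp [hy]
    · have e : |y| ^ p = |y| ^ (p - 2) * (y * y) := by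
        rw [← abs_mul_abs_self y, ← pow_two, ← Real.rpow_natCast, ← Real.rpow_add (by positivity)]
        norm_num
      rw [e]; ring
  · have h1 := hasDerivAt_abs_rpow x (p := p) (by linarith)
    have h2 := h1.mul (Real.hasDerivAt_log hx)
    simp only [Real.log_abs]
    refine h2.congr_deriv ?_
    have e : |x| ^ p = |x| ^ (p - 2) * (x * x) := by
      rw [← abs_mul_abs_self x, ← pow_two, ← Real.rpow_natCast, ← Real.rpow_add (by positivity)]
      norm_num
    rw [e]; field_simp

end Scalar

/-! ### Differentiation under the integral sign and Fatou's lemma -/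

section Integral

variable {α : Type*} [MeasurableSpace α] {μ : Measure α}

theorem memLp_ofReal_iff {f : α → ℝ} (hf : AEStronglyMeasurable f μ) {p : ℝ} (hp : 0 < p) :
    MemLp f (ENNReal.ofReal p) μ ↔ Integrable (fun x => |f x| ^ p) μ := by
  have := integrable_norm_rpow_iff (p := ENNReal.ofReal p) hf (by simpa using hp)
    ENNReal.ofReal_ne_top
  rw [ENNReal.toReal_ofReal hp.le] at this
  exact this.symm

theorem MemLp.integrable_abs_rpow {f : α → ℝ} {p : ℝ} (hp : 0 < p)
    (hf : MemLp f (ENNReal.ofReal p) μ) : Integrable (fun x => |f x| ^ p) μ :=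
  (memLp_ofReal_iff hf.1 hp).1 hf

theorem abs_add_smul_le {a b t : ℝ} (ht : t ∈ Metric.ball (0 : ℝ) 1) :
    |a + t * b| ≤ |a| + |b| := by
  have ht' : |t| ≤ 1 := by simpa using (Metric.mem_ball.1 ht).le
  calc |a + t * b| ≤ |a| + |t * b| := abs_add_le _ _
    _ ≤ |a| + |b| := by
      rw [abs_mul]; gcongr; exact mul_le_of_le_one_left (abs_nonneg _) ht'

theorem MemLp.abs_add_abs {f h : α → ℝ} {q : ENNReal} (hf : MemLp f q μ) (hh : MemLp h q μ) :
    MemLp (fun x => |f x| + |h x|) q μ := hf.norm.add hh.norm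

theorem aestronglyMeasurable_abs_rpow {f : α → ℝ} (hf : AEStronglyMeasurable f μ) (p : ℝ) :
    AEStronglyMeasurable (fun x => |f x| ^ p) μ := by
  have := hf.aemeasurable
  exact AEMeasurable.aestronglyMeasurable (by fun_prop)

/-- For `|t| < 1` the derivative is dominated by `p (|f| + |h|)^p`. The measure space is general
because the lemma serves both functions on `Ω` and difference quotients on the product space. -/
theorem hasDerivAt_integral_abs_rpow {f h : α → ℝ} {p : ℝ} (hp : 2 ≤ p)
    (hf : MemLp f (ENNReal.ofReal p) μ) (hh : MemLp h (ENNReal.ofReal p) μ) :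
    Integrable (fun x => |f x| ^ (p - 2) * f x * h x) μ ∧
    HasDerivAt (fun t : ℝ => ∫ x, |f x + t * h x| ^ p ∂μ)
      (p * ∫ x, |f x| ^ (p - 2) * f x * h x ∂μ) 0 := by
  have hp0 : 0 < p := by linarith
  have hfm := hf.1.aemeasurable
  have hhm := hh.1.aemeasurable
  have key := hasDerivAt_integral_of_dominated_loc_of_deriv_le (μ := μ) (𝕜 := ℝ)
    (F := fun t x => |f x + t * h x| ^ p) (x₀ := 0)
    (F' := fun t x => p * |f x + t * h x| ^ (p - 2) * (f x + t * h x) * h x)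
    (bound := fun x => p * |(|f x| + |h x|)| ^ p)
    (Metric.ball_mem_nhds (0 : ℝ) one_pos) ?_ ?_ ?_ ?_ ?_ ?_
  · obtain ⟨h1, h2⟩ := key
    simp only [zero_mul, add_zero] at h1 h2
    have e : ∀ x, p * |f x| ^ (p - 2) * f x * h x = p * (|f x| ^ (p - 2) * f x * h x) :=
      fun x => by ring
    simp only [e, integral_const_mul] at h1 h2
    refine ⟨?_, h2⟩
    simpa [hp0.ne'] using h1.const_mul p⁻¹
  · exact Eventually.of_forall fun t =>
      aestronglyMeasurable_abs_rpow (hf.1.add (hh.1.const_mul t)) p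
  · simpa using MemLp.integrable_abs_rpow hp0 hf
  · exact AEMeasurable.aestronglyMeasurable (by fun_prop)
  · refine Eventually.of_forall fun x t ht => ?_
    have h1 := abs_add_smul_le (a := f x) (b := h x) ht
    set y := f x + t * h x
    set z := |f x| + |h x| with hz
    have hz0 : 0 ≤ z := by positivity
    have hhz : |h x| ≤ z := by rw [hz]; linarith [abs_nonneg (f x)]
    rw [Real.norm_eq_abs, abs_mul, abs_mul, abs_mul, abs_of_pos hp0,
      abs_of_nonneg (Real.rpow_nonneg (abs_nonneg y) _), abs_of_nonneg hz0]
    calc p * |y| ^ (p - 2) * |y| * |h x| ≤ p * z ^ (p - 2) * z * z := by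
          gcongr
      _ = p * z ^ p := by
          rcases hz0.eq_or_lt with h0 | h0
          · rw [← h0, Real.zero_rpow hp0.ne']; simp
          · have : z ^ p = z ^ (p - 2) * (z * z) := by
              rw [← pow_two, ← Real.rpow_natCast, ← Real.rpow_add h0]; norm_num
            rw [this]; ring
  · exact (MemLp.integrable_abs_rpow hp0 (MemLp.abs_add_abs hf hh)).const_mul p
  · refine Eventually.of_forall fun x t _ => ?_
    have h1 : HasDerivAt (fun t : ℝ => f x + t * h x) (h x) t := by
      simpa using ((hasDerivAt_id t).mul_const (h x)).const_add (f x)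
    exact (hasDerivAt_abs_rpow _ (by linarith)).comp t h1

theorem integrable_abs_rpow_mul_log [IsFiniteMeasure μ] {f : α → ℝ} {p κ : ℝ} (hp : 1 ≤ p)
    (hκ : 0 < κ) (hf : MemLp f (ENNReal.ofReal (p + κ)) μ) :
    Integrable (fun x => |f x| ^ p * Real.log |f x|) μ := by
  have hfm := hf.1.aemeasurable
  refine Integrable.mono' (g := fun x => 1 + |f x| ^ (p + κ) / κ)
    ((integrable_const _).add ((MemLp.integrable_abs_rpow (by linarith) hf).div_const κ))
    (AEMeasurable.aestronglyMeasurable ?_) (Eventually.of_forall fun x => ?_)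
  · exact (hfm.abs.pow_const p).mul (Real.measurable_log.comp_aemeasurable hfm.abs)
  · rw [Real.norm_eq_abs, abs_mul, abs_of_nonneg (Real.rpow_nonneg (abs_nonneg _) _)]
    exact rpow_mul_abs_log_le hp hκ (abs_nonneg _)

/-- The surplus integrability `κ` pays for the logarithm: with `z = |f| + |h|` the derivative is
dominated by a multiple of `z` plus a multiple of `z^(p + κ)`. The linear term is integrable because
the measure is finite. -/
theorem hasDerivAt_integral_abs_rpow_mul_log [IsFiniteMeasure μ] {f h : α → ℝ} {p κ : ℝ}
    (hp : 2 ≤ p) (hκ : 0 < κ) (hf : MemLp f (ENNReal.ofReal (p + κ)) μ)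
    (hh : MemLp h (ENNReal.ofReal (p + κ)) μ) :
    Integrable (fun x => (p * |f x| ^ (p - 2) * f x * Real.log |f x| + |f x| ^ (p - 2) * f x) * h x)
      μ ∧
    HasDerivAt (fun t : ℝ => ∫ x, |f x + t * h x| ^ p * Real.log |f x + t * h x| ∂μ)
      (∫ x, (p * |f x| ^ (p - 2) * f x * Real.log |f x| + |f x| ^ (p - 2) * f x) * h x ∂μ) 0 := by
  have hq0 : 0 < p + κ := by linarith
  have hfm := hf.1.aemeasurable
  have hhm := hh.1.aemeasurable
  have habs : MemLp (fun x => |f x| + |h x|) (ENNReal.ofReal (p + κ)) μ := MemLp.abs_add_abs hf hh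
  have key := hasDerivAt_integral_of_dominated_loc_of_deriv_le (μ := μ) (𝕜 := ℝ)
    (F := fun t x => |f x + t * h x| ^ p * Real.log |f x + t * h x|) (x₀ := 0)
    (F' := fun t x => (p * |f x + t * h x| ^ (p - 2) * (f x + t * h x) * Real.log |f x + t * h x|
      + |f x + t * h x| ^ (p - 2) * (f x + t * h x)) * h x)
    (bound := fun x => (p + 1) * (|f x| + |h x|) + (p / κ + 1) * |(|f x| + |h x|)| ^ (p + κ))
    (Metric.ball_mem_nhds (0 : ℝ) one_pos) ?_ ?_ ?_ ?_ ?_ ?_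
  · simpa only [zero_mul, add_zero] using key
  · refine Eventually.of_forall fun t => AEMeasurable.aestronglyMeasurable ?_
    have h1 : AEMeasurable (fun x => |f x + t * h x|) μ := by fun_prop
    exact (h1.pow_const p).mul (Real.measurable_log.comp_aemeasurable h1)
  · simpa using integrable_abs_rpow_mul_log (by linarith) hκ hf
  · refine AEMeasurable.aestronglyMeasurable ?_
    have h1 : AEMeasurable (fun x => Real.log |f x + 0 * h x|) μ :=
      Real.measurable_log.comp_aemeasurable (by fun_prop)
    exact AEMeasurable.mul (AEMeasurable.add (AEMeasurable.mul (by fun_prop) h1) (by fun_prop)) hhm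
  · refine Eventually.of_forall fun x t ht => ?_
    have h1 := abs_add_smul_le (a := f x) (b := h x) ht
    set y := f x + t * h x
    set z := |f x| + |h x| with hz
    have hz0 : 0 ≤ z := by positivity
    have hhz : |h x| ≤ z := by rw [hz]; linarith [abs_nonneg (f x)]
    have ey : |y| ^ (p - 2) * |y| = |y| ^ (p - 1) := by
      rcases (abs_nonneg y).eq_or_lt with h0 | h0
      · rw [← h0, Real.zero_rpow (show p - 1 ≠ 0 by linarith)]; simp
      · conv_lhs => rw [← Real.rpow_add_one h0.ne']
        congr 1; ring
    have ez : z ^ (p - 1 + κ) * z = z ^ (p + κ) := by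
      rcases hz0.eq_or_lt with h0 | h0
      · rw [← h0, Real.zero_rpow (by linarith)]; simp; rw [Real.zero_rpow (by linarith)]
      · rw [← Real.rpow_add_one h0.ne']; congr 1; ring
    have b1 : |y| ^ (p - 1) * |Real.log (|y|)| ≤ 1 + z ^ (p - 1 + κ) / κ :=
      (rpow_mul_abs_log_le (by linarith) hκ (abs_nonneg y)).trans (by gcongr; linarith)
    have b2 : |y| ^ (p - 1) ≤ 1 + z ^ (p - 1 + κ) := by
      refine (Real.rpow_le_rpow (abs_nonneg y) h1 (by linarith)).trans ?_
      rcases le_total z 1 with h | h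
      · have := Real.rpow_le_one hz0 h (z := p - 1) (by linarith)
        have := Real.rpow_nonneg hz0 (p - 1 + κ)
        linarith
      · have := Real.rpow_le_rpow_of_exponent_le h (show p - 1 ≤ p - 1 + κ by linarith)
        linarith
    rw [Real.norm_eq_abs, abs_mul]
    have b3 : |p * |y| ^ (p - 2) * y * Real.log |y| + |y| ^ (p - 2) * y|
        ≤ (p + 1) + (p / κ + 1) * z ^ (p - 1 + κ) := by
      refine (abs_add_le _ _).trans ?_
      have c1 : |p * |y| ^ (p - 2) * y * Real.log (|y|)| = p * (|y| ^ (p - 1) * |Real.log (|y|)|) := by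
        rw [abs_mul, abs_mul, abs_mul, abs_of_pos (show 0 < p by linarith),
          abs_of_nonneg (Real.rpow_nonneg (abs_nonneg y) _), ← ey]; ring
      have c2 : |(|y| ^ (p - 2) * y)| = |y| ^ (p - 1) := by
        rw [abs_mul, abs_of_nonneg (Real.rpow_nonneg (abs_nonneg y) _), ey]
      rw [c1, c2]
      have := mul_le_mul_of_nonneg_left b1 (show 0 ≤ p by linarith)
      have e3 : p * (1 + z ^ (p - 1 + κ) / κ) = p + p / κ * z ^ (p - 1 + κ) := by ring
      rw [e3] at this
      linarith
    calc _ ≤ ((p + 1) + (p / κ + 1) * z ^ (p - 1 + κ)) * z := by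
          gcongr
      _ = _ := by rw [abs_of_nonneg hz0, ← ez]; ring
  · refine Integrable.add (Integrable.const_mul (habs.integrable ?_) _)
      ((MemLp.integrable_abs_rpow hq0 habs).const_mul _)
    rw [← ENNReal.ofReal_one]; exact ENNReal.ofReal_le_ofReal (by linarith)
  · refine Eventually.of_forall fun x t _ => ?_
    have h1 : HasDerivAt (fun t : ℝ => f x + t * h x) (h x) t := by
      simpa using ((hasDerivAt_id t).mul_const (h x)).const_add (f x)
    exact (hasDerivAt_abs_rpow_mul_log _ hp).comp t h1

/-- Fatou's lemma for integrals of nonnegative real functions. -/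
theorem eventually_integral_le_add_of_tendsto {F : ℕ → α → ℝ} {G : α → ℝ}
    (hF : ∀ n, Integrable (F n) μ) (hF0 : ∀ n x, 0 ≤ F n x) (hG : Integrable G μ)
    (hlim : ∀ᵐ x ∂μ, Tendsto (fun n => F n x) atTop (𝓝 (G x))) {ε : ℝ} (hε : 0 < ε) :
    ∀ᶠ n in atTop, ∫ x, G x ∂μ ≤ (∫ x, F n x ∂μ) + ε := by
  have hG0 : 0 ≤ᵐ[μ] G := hlim.mono fun x hx => ge_of_tendsto' hx fun n => hF0 n x
  have h1 : ∫⁻ x, ENNReal.ofReal (G x) ∂μ ≤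
      liminf (fun n => ∫⁻ x, ENNReal.ofReal (F n x) ∂μ) atTop := by
    refine le_trans (lintegral_mono_ae ?_)
      (lintegral_liminf_le' fun n => (hF n).aestronglyMeasurable.aemeasurable.ennreal_ofReal)
    filter_upwards [hlim] with x hx
    exact (ENNReal.tendsto_ofReal hx).liminf_eq.ge
  rw [← ofReal_integral_eq_lintegral_ofReal hG hG0] at h1
  rcases le_or_gt (∫ x, G x ∂μ) 0 with h0 | h0
  -- `ENNReal.ofReal` truncates at zero, so the strict inequality used below needs a positive
  -- integral of `G`; the other case is trivial.
  · refine Eventually.of_forall fun n => ?_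
    have := integral_nonneg (μ := μ) (f := F n) (hF0 n)
    linarith
  have h2 : ENNReal.ofReal (∫ x, G x ∂μ - ε) <
      liminf (fun n => ∫⁻ x, ENNReal.ofReal (F n x) ∂μ) atTop :=
    lt_of_lt_of_le ((ENNReal.ofReal_lt_ofReal_iff h0).2 (by linarith)) h1
  filter_upwards [eventually_lt_of_lt_liminf h2] with n hn
  rw [← ofReal_integral_eq_lintegral_ofReal (hF n) (Eventually.of_forall (hF0 n))] at hn
  by_contra! h
  exact absurd hn (not_lt.2 (ENNReal.ofReal_le_ofReal (by linarith)))

end Integral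

/-! ### The space `W0` and its functionals through difference quotients -/

variable {N : ℕ} {s p : ℝ} {Ω : Set (EuclideanSpace ℝ (Fin N))}

local notation "𝔼" => EuclideanSpace ℝ (Fin N)

/-- The fractional difference quotient, whose `L^p` norm is the Gagliardo seminorm. -/
noncomputable def diffQuot {N : ℕ} (s p : ℝ) (u : EuclideanSpace ℝ (Fin N) → ℝ)
    (z : EuclideanSpace ℝ (Fin N) × EuclideanSpace ℝ (Fin N)) : ℝ :=
  (u z.1 - u z.2) / ‖z.1 - z.2‖ ^ (((N : ℝ) + s * p) / p)

theorem abs_diffQuot_rpow (hp : p ≠ 0) (u : 𝔼 → ℝ) (z : 𝔼 × 𝔼) :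
    |diffQuot s p u z| ^ p = |u z.1 - u z.2| ^ p / ‖z.1 - z.2‖ ^ ((N : ℝ) + s * p) := by
  have h0 : 0 ≤ ‖z.1 - z.2‖ := norm_nonneg _
  rw [diffQuot, abs_div, Real.div_rpow (abs_nonneg _) (abs_nonneg _),
    abs_of_nonneg (Real.rpow_nonneg h0 _), ← Real.rpow_mul h0, div_mul_cancel₀ _ hp]

theorem diffQuot_add_smul (u v : 𝔼 → ℝ) (t : ℝ) (z : 𝔼 × 𝔼) :
    diffQuot s p (u + t • v) z = diffQuot s p u z + t * diffQuot s p v z := by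
  simp only [diffQuot, Pi.add_apply, Pi.smul_apply, smul_eq_mul]; ring

theorem aestronglyMeasurable_diffQuot {u : 𝔼 → ℝ} (hu : AEStronglyMeasurable u volume) :
    AEStronglyMeasurable (diffQuot s p u) (volume.prod volume) := by
  have h1 : AEMeasurable (fun z : 𝔼 × 𝔼 => u z.1) (volume.prod volume) := hu.comp_fst.aemeasurable
  have h2 : AEMeasurable (fun z : 𝔼 × 𝔼 => u z.2) (volume.prod volume) := hu.comp_snd.aemeasurable
  refine AEMeasurable.aestronglyMeasurable ((h1.sub h2).div ?_)
  exact Measurable.aemeasurable (by fun_prop)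

theorem gagliardoPow_eq (hp : p ≠ 0) {u : 𝔼 → ℝ} (hu : AEStronglyMeasurable u volume) :
    gagliardoPow N s p u = ∫⁻ z, ENNReal.ofReal (|diffQuot s p u z| ^ p) ∂(volume.prod volume) := by
  rw [lintegral_prod _ (aestronglyMeasurable_abs_rpow (aestronglyMeasurable_diffQuot hu)
    p).aemeasurable.ennreal_ofReal]
  simp only [abs_diffQuot_rpow hp, gagliardoPow]

theorem memLp_diffQuot_iff (hp : 0 < p) {u : 𝔼 → ℝ} (hu : AEStronglyMeasurable u volume) :
    MemLp (diffQuot s p u) (ENNReal.ofReal p) (volume.prod volume) ↔ gagliardoPow N s p u < ⊤ := by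
  rw [memLp_ofReal_iff (aestronglyMeasurable_diffQuot hu) hp, gagliardoPow_eq hp.ne' hu]
  refine ⟨fun h => ?_, fun h => ⟨aestronglyMeasurable_abs_rpow (aestronglyMeasurable_diffQuot hu) p,
    ?_⟩⟩
  · rw [← ofReal_integral_eq_lintegral_ofReal h
      (Eventually.of_forall fun z => Real.rpow_nonneg (abs_nonneg _) _)]
    exact ENNReal.ofReal_lt_top
  · rwa [hasFiniteIntegral_iff_ofReal
      (Eventually.of_forall fun z => Real.rpow_nonneg (abs_nonneg _) _)]

theorem toReal_gagliardoPow (hp : p ≠ 0) {u : 𝔼 → ℝ} (hu : AEStronglyMeasurable u volume) :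
    (gagliardoPow N s p u).toReal = ∫ z, |diffQuot s p u z| ^ p ∂(volume.prod volume) := by
  rw [gagliardoPow_eq hp hu, integral_eq_lintegral_of_nonneg_ae
    (Eventually.of_forall fun z => Real.rpow_nonneg (abs_nonneg _) _)
    (aestronglyMeasurable_abs_rpow (aestronglyMeasurable_diffQuot hu) p)]

theorem W0.memLp_diffQuot (hp : 0 < p) {u : 𝔼 → ℝ} (hu : u ∈ W0 Ω s p) :
    MemLp (diffQuot s p u) (ENNReal.ofReal p) (volume.prod volume) :=
  (memLp_diffQuot_iff hp hu.1.1).2 hu.2.1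

theorem W0.add_smul (hp : 0 < p) {u v : 𝔼 → ℝ} (hu : u ∈ W0 Ω s p) (hv : v ∈ W0 Ω s p) (t : ℝ) :
    u + t • v ∈ W0 Ω s p := by
  have h1 : MemLp (u + t • v) (ENNReal.ofReal p) volume := hu.1.add (hv.1.const_smul t)
  refine ⟨h1, (memLp_diffQuot_iff hp h1.1).1 ?_, ?_⟩
  · have h2 := (W0.memLp_diffQuot hp hu).add ((W0.memLp_diffQuot hp hv).const_mul t)
    refine h2.congr_norm (aestronglyMeasurable_diffQuot h1.1) (Eventually.of_forall fun z => ?_)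
    rw [diffQuot_add_smul]; rfl
  · filter_upwards [hu.2.2, hv.2.2] with x h2 h3 hx
    simp [h2 hx, h3 hx]

theorem W0.zero_mem (hp : 0 < p) : (0 : 𝔼 → ℝ) ∈ W0 Ω s p := by
  refine ⟨MemLp.zero, ?_, by simp⟩
  simp [gagliardoPow, Real.zero_rpow hp.ne']

theorem W0.smul_mem (hp : 0 < p) {u : 𝔼 → ℝ} (hu : u ∈ W0 Ω s p) (t : ℝ) : t • u ∈ W0 Ω s p := by
  simpa using W0.add_smul hp (W0.zero_mem hp) hu t

theorem W0.sub_mem (hp : 0 < p) {u v : 𝔼 → ℝ} (hu : u ∈ W0 Ω s p) (hv : v ∈ W0 Ω s p) :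
    u - v ∈ W0 Ω s p := by
  simpa [sub_eq_add_neg] using W0.add_smul hp hu hv (-1)

theorem gagliardoPow_smul (hp : p ≠ 0) {u : 𝔼 → ℝ} (hu : AEStronglyMeasurable u volume) (l : ℝ) :
    (gagliardoPow N s p (l • u)).toReal = |l| ^ p * (gagliardoPow N s p u).toReal := by
  rw [toReal_gagliardoPow hp hu, toReal_gagliardoPow hp (hu.const_smul l), ← integral_const_mul]
  congr 1 with z
  have := diffQuot_add_smul (s := s) (p := p) (0 : 𝔼 → ℝ) u l z
  rw [zero_add] at this
  rw [this, show diffQuot s p (0 : 𝔼 → ℝ) z = 0 by simp [diffQuot], zero_add, abs_mul,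
    Real.mul_rpow (abs_nonneg _) (abs_nonneg _)]

theorem normPow_smul (u : 𝔼 → ℝ) (l : ℝ) :
    normPow Ω p (l • u) = |l| ^ p * normPow Ω p u := by
  rw [normPow, normPow, ← integral_const_mul]
  congr 1 with z
  rw [Pi.smul_apply, smul_eq_mul, abs_mul, Real.mul_rpow (abs_nonneg _) (abs_nonneg _)]

theorem normPow_nonneg (u : 𝔼 → ℝ) : 0 ≤ normPow Ω p u :=
  integral_nonneg fun _ => Real.rpow_nonneg (abs_nonneg _) _

theorem W0.setIntegral_eq (hΩ : MeasurableSet Ω) {u : 𝔼 → ℝ} (hu : u ∈ W0 Ω s p) {φ : ℝ → ℝ}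
    (hφ : φ 0 = 0) : ∫ x in Ω, φ (u x) = ∫ x, φ (u x) := by
  rw [← integral_indicator hΩ]
  refine integral_congr_ae ?_
  filter_upwards [hu.2.2] with x hx
  by_cases h : x ∈ Ω
  · simp [h]
  · simp [h, hx h, hφ]

theorem normPow_eq (hp : p ≠ 0) (hΩ : MeasurableSet Ω) {u : 𝔼 → ℝ} (hu : u ∈ W0 Ω s p) :
    normPow Ω p u = ∫ x, |u x| ^ p :=
  W0.setIntegral_eq hΩ hu (φ := fun t => |t| ^ p) (by simp [Real.zero_rpow hp])

theorem normPow_pos (hp : 0 < p) (hΩ : MeasurableSet Ω) {u : 𝔼 → ℝ} (hu : u ∈ X0 Ω s p) :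
    0 < normPow Ω p u := by
  refine lt_of_le_of_ne (normPow_nonneg u) fun h => hu.2 ?_
  rw [normPow_eq hp.ne' hΩ hu.1, eq_comm, integral_eq_zero_iff_of_nonneg
    (fun _ => Real.rpow_nonneg (abs_nonneg _) _) (MemLp.integrable_abs_rpow hp hu.1.1)] at h
  filter_upwards [h] with x hx
  have hx : |u x| ^ p = 0 := hx
  simpa using (Real.rpow_eq_zero (abs_nonneg _) hp.ne').1 hx

theorem mem_X0_of_normPow_pos (hp : 0 < p) (hΩ : MeasurableSet Ω) {u : 𝔼 → ℝ} (hu : u ∈ W0 Ω s p)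
    (h : 0 < normPow Ω p u) : u ∈ X0 Ω s p := by
  refine ⟨hu, fun h0 => h.ne' ?_⟩
  rw [normPow_eq hp.ne' hΩ hu]
  refine integral_eq_zero_of_ae ?_
  filter_upwards [h0] with x hx
  simp [hx, Real.zero_rpow hp.ne']

/-- The difference quotient is linear in `u` and carries the seminorm to an `L^p` norm on the
product, so the abstract derivative applies; Fubini turns it into `formK`. -/
theorem hasDerivAt_gagliardoPow (hp : 2 ≤ p) {u v : 𝔼 → ℝ} (hu : u ∈ W0 Ω s p)
    (hv : v ∈ W0 Ω s p) :
    HasDerivAt (fun t : ℝ => (gagliardoPow N s p (u + t • v)).toReal) (p * formK N s p u v) 0 := by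
  have hp0 : 0 < p := by linarith
  obtain ⟨h1, h2⟩ := hasDerivAt_integral_abs_rpow hp (W0.memLp_diffQuot hp0 hu)
    (W0.memLp_diffQuot hp0 hv)
  have e1 : ∀ t : ℝ, (gagliardoPow N s p (u + t • v)).toReal =
      ∫ z, |diffQuot s p u z + t * diffQuot s p v z| ^ p ∂(volume.prod volume) := fun t => by
    rw [toReal_gagliardoPow hp0.ne' (W0.add_smul hp0 hu hv t).1.1]
    simp only [diffQuot_add_smul]
  simp only [e1]
  convert h2 using 2
  rw [integral_prod _ h1, formK]
  congr 1 with x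
  congr 1 with y
  simp only [diffQuot]
  have h0 : 0 ≤ ‖x - y‖ := norm_nonneg _
  -- On the diagonal the kernel is singular, but both numerators vanish.
  rcases h0.eq_or_lt with hxy | hxy
  · have : x = y := by simpa [sub_eq_zero] using hxy.symm
    simp [this]
  · have e2 : ‖x - y‖ ^ ((N : ℝ) + s * p) = (‖x - y‖ ^ (((N : ℝ) + s * p) / p)) ^ (p - 2) *
        (‖x - y‖ ^ (((N : ℝ) + s * p) / p) * ‖x - y‖ ^ (((N : ℝ) + s * p) / p)) := by
      rw [← pow_two, ← Real.rpow_natCast (_ ^ _) 2, ← Real.rpow_add (by positivity),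
        ← Real.rpow_mul h0]
      congr 1; push_cast; field_simp; ring
    rw [e2, abs_div, Real.div_rpow (abs_nonneg _) (abs_nonneg _),
      abs_of_nonneg (Real.rpow_nonneg h0 (((N : ℝ) + s * p) / p))]
    have : 0 < ‖x - y‖ ^ (((N : ℝ) + s * p) / p) := by positivity
    have : 0 < (‖x - y‖ ^ (((N : ℝ) + s * p) / p)) ^ (p - 2) := by positivity
    field_simp

theorem hasDerivAt_normPow (hp : 2 ≤ p) {u v : 𝔼 → ℝ} (hu : u ∈ W0 Ω s p) (hv : v ∈ W0 Ω s p) :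
    HasDerivAt (fun t : ℝ => normPow Ω p (u + t • v))
      (p * ∫ x in Ω, |u x| ^ (p - 2) * u x * v x) 0 :=
  (hasDerivAt_integral_abs_rpow hp (hu.1.restrict Ω) (hv.1.restrict Ω)).2

/-! ### The Gagliardo–Nirenberg inequality -/

theorem volume_ball_eq (x : EuclideanSpace ℝ (Fin N)) {r : ℝ} (hr : 0 < r) :
    volume (Metric.ball x r) =
      ENNReal.ofReal (r ^ N * (volume (Metric.ball (0 : EuclideanSpace ℝ (Fin N)) 1)).toReal) := by
  rw [Measure.addHaar_ball_of_pos _ _ hr, finrank_euclideanSpace_fin, ENNReal.ofReal_mul (by positivity),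
    ENNReal.ofReal_toReal measure_ball_lt_top.ne]

theorem volume_unitBall_pos :
    0 < (volume (Metric.ball (0 : EuclideanSpace ℝ (Fin N)) 1)).toReal :=
  ENNReal.toReal_pos (Metric.measure_ball_pos _ _ one_pos).ne' measure_ball_lt_top.ne

theorem aemeasurable_gagliardo_inner {u : 𝔼 → ℝ} (hu : AEStronglyMeasurable u volume) (x : 𝔼) :
    AEMeasurable (fun y => ENNReal.ofReal (|u x - u y| ^ p / ‖x - y‖ ^ ((N : ℝ) + s * p)))
      volume := by
  have := hu.aemeasurable
  refine AEMeasurable.ennreal_ofReal (AEMeasurable.div ?_ ?_)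
  · fun_prop
  · exact Measurable.aemeasurable (by fun_prop)

/-- A pointwise lower bound for the inner Gagliardo integral: the ball around `x` on which
`|u| > |u x| / 2` can fill at most half of the volume has radius controlled by `‖u‖_p`. -/
theorem rpow_le_gagliardo_inner (hN : 0 < N) (hs : 0 < s) (hp : 0 < p) {u : 𝔼 → ℝ}
    (hu : MemLp u (ENNReal.ofReal p) volume) (hm : 0 < ∫ x, |u x| ^ p) (x : 𝔼) :
    ENNReal.ofReal
        (((volume (Metric.ball (0 : 𝔼) 1)).toReal / 2 ^ (p + 1)) ^ (1 + s * p / N) *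
          (∫ x, |u x| ^ p) ^ (-(s * p / N)) * |u x| ^ (p + s * p / N * p)) ≤
      ∫⁻ y, ENNReal.ofReal (|u x - u y| ^ p / ‖x - y‖ ^ ((N : ℝ) + s * p)) := by
  have hN' : (0 : ℝ) < N := by exact_mod_cast hN
  set m := ∫ x, |u x| ^ p with hmdef
  set ω := (volume (Metric.ball (0 : 𝔼) 1)).toReal with hω
  have hω0 : 0 < ω := volume_unitBall_pos
  set σ := s * p / N with hσ
  have hσ0 : 0 < σ := by positivity
  rcases (abs_nonneg (u x)).eq_or_lt with h0 | ht
  · rw [← h0, Real.zero_rpow (by positivity)]; simp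
  set t := |u x| with htdef
  -- By Chebyshev, `{|u| ≥ t/2}` has volume at most `b = 2^p m / t^p`. The radius `r = K^(1/N)` is
  -- chosen so that the ball has volume `2b`; at least `b` of it then satisfies `|u x - u y| ≥ t/2`
  -- and `|x - y| < r`.
  set K := 2 ^ (p + 1) * m / (ω * t ^ p) with hK
  have hK0 : 0 < K := by positivity
  set r := K ^ (1 / (N : ℝ)) with hr
  have hr0 : 0 < r := by positivity
  have hrN : r ^ N = K := by
    rw [hr, ← Real.rpow_natCast, ← Real.rpow_mul hK0.le, one_div, inv_mul_cancel₀ hN'.ne',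
      Real.rpow_one]
  set b := 2 ^ p * m / t ^ p with hb
  have hb0 : 0 < b := by positivity
  have hBall : volume (Metric.ball x r) = ENNReal.ofReal (2 * b) := by
    rw [volume_ball_eq x hr0, hrN, hK, ← hω, hb, Real.rpow_add two_pos, Real.rpow_one]
    congr 1; field_simp
  set A := {y : 𝔼 | ENNReal.ofReal ((t / 2) ^ p) ≤ ENNReal.ofReal (|u y| ^ p)} with hA
  have hAvol : volume A ≤ ENNReal.ofReal b := by
    have h1 := mul_meas_ge_le_lintegral₀ (μ := (volume : Measure 𝔼))
      (aestronglyMeasurable_abs_rpow hu.1 p).aemeasurable.ennreal_ofReal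
      (ENNReal.ofReal ((t / 2) ^ p))
    rw [← ofReal_integral_eq_lintegral_ofReal (MemLp.integrable_abs_rpow hp hu)
      (Eventually.of_forall fun _ => Real.rpow_nonneg (abs_nonneg _) _), ← hmdef] at h1
    have h2 : ENNReal.ofReal m = ENNReal.ofReal ((t / 2) ^ p) * ENNReal.ofReal b := by
      rw [← ENNReal.ofReal_mul (by positivity), hb, Real.div_rpow ht.le two_pos.le]
      congr 1; field_simp
    rw [h2] at h1
    exact (ENNReal.mul_le_mul_iff_right (by simpa using by positivity) ENNReal.ofReal_ne_top).1 h1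
  set w := (t / 2) ^ p / r ^ ((N : ℝ) + s * p) with hw
  have hsub : Metric.ball x r \ A ⊆
      {y | ENNReal.ofReal w ≤ ENNReal.ofReal (|u x - u y| ^ p / ‖x - y‖ ^ ((N : ℝ) + s * p))} := by
    rintro y ⟨hy, hyA⟩
    rw [Metric.mem_ball, dist_eq_norm, norm_sub_rev] at hy
    have h1 : |u y| < t / 2 := by
      by_contra! h
      exact hyA (ENNReal.ofReal_le_ofReal (Real.rpow_le_rpow (by positivity) h hp.le))
    have h2 : t / 2 ≤ |u x - u y| := by
      have := abs_sub_abs_le_abs_sub (u x) (u y)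
      rw [← htdef] at this; linarith
    have h3 : 0 < ‖x - y‖ := by
      rw [norm_pos_iff, sub_ne_zero]
      rintro rfl
      rw [← htdef] at h1; linarith
    refine ENNReal.ofReal_le_ofReal ?_
    rw [hw]; gcongr
  have h1 := mul_meas_ge_le_lintegral₀ (aemeasurable_gagliardo_inner (s := s) (p := p) hu.1 x)
    (ENNReal.ofReal w)
  refine le_trans ?_ h1
  have h2 : ENNReal.ofReal b ≤ volume (Metric.ball x r \ A) := by
    refine le_trans ?_ le_measure_sdiff
    rw [hBall]
    refine le_trans ?_ (tsub_le_tsub_left hAvol _)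
    rw [← ENNReal.ofReal_sub _ hb0.le]
    exact ENNReal.ofReal_le_ofReal (by linarith)
  refine le_trans ?_ (mul_le_mul_right (h2.trans (measure_mono hsub)) _)
  rw [← ENNReal.ofReal_mul (by positivity)]
  refine ENNReal.ofReal_le_ofReal (le_of_eq ?_)
  have e1 : r ^ ((N : ℝ) + s * p) = K ^ (1 + σ) := by
    rw [hr, ← Real.rpow_mul hK0.le, hσ]; congr 1; field_simp
  rw [hw, hb, e1, hK, Real.div_rpow ht.le two_pos.le, Real.div_rpow (by positivity) (by positivity),
    Real.div_rpow (by positivity) (by positivity),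
    Real.mul_rpow (by positivity) (by positivity), Real.mul_rpow (by positivity) (by positivity),
    Real.rpow_neg hm.le, Real.rpow_add hm, Real.rpow_one, Real.rpow_add ht p, ← Real.rpow_mul ht.le,
    show p * (1 + σ) = p + σ * p by ring, Real.rpow_add ht p]
  have := Real.rpow_pos_of_pos hm σ
  field_simp

/-- A Gagliardo–Nirenberg inequality: `W_0^{s,p}` embeds into `L^{p + s p² / N}`. -/
theorem exists_gagliardo_nirenberg (hN : 0 < N) (hs : 0 < s) (hp : 0 < p) :
    ∃ c : ℝ, 0 < c ∧ ∀ u ∈ W0 Ω s p, 0 < ∫ x, |u x| ^ p →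
      MemLp u (ENNReal.ofReal (p + s * p / N * p)) volume ∧
      ∫ x, |u x| ^ (p + s * p / N * p) ≤
        c * (∫ x, |u x| ^ p) ^ (s * p / N) * (gagliardoPow N s p u).toReal := by
  have hω0 : 0 < (volume (Metric.ball (0 : 𝔼) 1)).toReal := volume_unitBall_pos
  have hN' : (0 : ℝ) < N := by exact_mod_cast hN
  set c := ((volume (Metric.ball (0 : 𝔼) 1)).toReal / 2 ^ (p + 1)) ^ (1 + s * p / N) with hc
  have hc0 : 0 < c := by positivity
  refine ⟨c⁻¹, by positivity, fun u hu hm => ?_⟩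
  set q := p + s * p / N * p with hq
  have hq0 : 0 < q := by positivity
  set m := ∫ x, |u x| ^ p
  set k := c * m ^ (-(s * p / N)) with hk
  have hk0 : 0 < k := by positivity
  -- Integrate the pointwise lower bound in `x`. As `k > 0`, this also shows that the left integral
  -- is finite.
  have h1 : ENNReal.ofReal k * ∫⁻ x, ENNReal.ofReal (|u x| ^ q) ≤ gagliardoPow N s p u := by
    rw [← lintegral_const_mul'' _ (aestronglyMeasurable_abs_rpow hu.1.1 q).aemeasurable.ennreal_ofReal]
    refine lintegral_mono fun x => ?_
    rw [← ENNReal.ofReal_mul hk0.le]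
    exact rpow_le_gagliardo_inner hN hs hp hu.1 hm x
  have hfin : ∫⁻ x, ENNReal.ofReal (|u x| ^ q) < ⊤ := by
    by_contra! h
    rw [top_le_iff] at h
    rw [h, ENNReal.mul_top (by simpa using hk0)] at h1
    exact (not_lt.2 h1) hu.2.1
  have hint : Integrable (fun x => |u x| ^ q) :=
    ⟨aestronglyMeasurable_abs_rpow hu.1.1 q, by
      rwa [hasFiniteIntegral_iff_ofReal
        (Eventually.of_forall fun z => Real.rpow_nonneg (abs_nonneg _) _)]⟩
  refine ⟨(memLp_ofReal_iff hu.1.1 hq0).2 hint, ?_⟩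
  rw [← ofReal_integral_eq_lintegral_ofReal hint
      (Eventually.of_forall fun z => Real.rpow_nonneg (abs_nonneg _) _),
    ← ENNReal.ofReal_mul hk0.le, ENNReal.ofReal_le_iff_le_toReal hu.2.1.ne, hk, Real.rpow_neg hm.le]
    at h1
  have : 0 < m ^ (s * p / N) := by positivity
  calc ∫ x, |u x| ^ q = c⁻¹ * m ^ (s * p / N) *
        (c * (m ^ (s * p / N))⁻¹ * ∫ x, |u x| ^ q) := by field_simp
    _ ≤ _ := by gcongr

/-! ### Compactness of the embedding into `L^p` -/

theorem convexOn_abs_rpow (hp : 1 ≤ p) : ConvexOn ℝ Set.univ fun x : ℝ => |x| ^ p := by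
  refine ⟨convex_univ, fun x _ y _ a b ha hb hab => ?_⟩
  refine le_trans (Real.rpow_le_rpow (abs_nonneg _) ?_ (by linarith))
    ((convexOn_rpow hp).2 (abs_nonneg x) (abs_nonneg y) ha hb hab)
  simp only [smul_eq_mul]
  refine (abs_add_le _ _).trans (le_of_eq ?_)
  rw [abs_mul, abs_mul, abs_of_nonneg ha, abs_of_nonneg hb]

/-- Jensen's inequality for `|·|^p` on a ball. -/
theorem abs_setAverage_rpow_le (hp : 1 ≤ p) {f : 𝔼 → ℝ} {c : 𝔼} {r : ℝ} (hr : 0 < r)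
    (hf : MemLp f (ENNReal.ofReal p) (volume.restrict (Metric.ball c r))) :
    |⨍ y in Metric.ball c r, f y| ^ p ≤ ⨍ y in Metric.ball c r, |f y| ^ p := by
  have hp0 : 0 < p := by linarith
  have : IsFiniteMeasure (volume.restrict (Metric.ball c r)) :=
    ⟨by rw [Measure.restrict_apply_univ]; exact measure_ball_lt_top⟩
  refine (convexOn_abs_rpow hp).map_set_average_le
    (continuous_abs.rpow_const fun _ => Or.inr hp0.le).continuousOn isClosed_univ
    (Metric.measure_ball_pos _ _ hr).ne' measure_ball_lt_top.ne (by simp)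
    (hf.integrable (by rw [← ENNReal.ofReal_one]; exact ENNReal.ofReal_le_ofReal hp))
    (MemLp.integrable_abs_rpow hp0 hf)

/-- Split `w x` into the average over the ball and the average of `w x - w y`. Jensen bounds the
second part, and `|x - y| ≤ 2r` inserts the singular kernel at the cost of `(2r)^(N + sp)`. -/
theorem abs_rpow_le_average_add (hp : 1 ≤ p) (hs : 0 < s) {w : 𝔼 → ℝ}
    (hw : MemLp w (ENNReal.ofReal p) volume) {c x : 𝔼} {r : ℝ} (hr : 0 < r)
    (hx : x ∈ Metric.ball c r) :
    ENNReal.ofReal (|w x| ^ p) ≤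
      ENNReal.ofReal (2 ^ (p - 1) * |⨍ y in Metric.ball c r, w y| ^ p) +
      ENNReal.ofReal (2 ^ (p - 1) * ((2 * r) ^ ((N : ℝ) + s * p) /
        (r ^ N * (volume (Metric.ball (0 : 𝔼) 1)).toReal))) *
      ∫⁻ y, ENNReal.ofReal (|w x - w y| ^ p / ‖x - y‖ ^ ((N : ℝ) + s * p)) := by
  have hp0 : 0 < p := by linarith
  set B := Metric.ball c r
  set ω := (volume (Metric.ball (0 : 𝔼) 1)).toReal with hω
  have hω0 : 0 < ω := volume_unitBall_pos
  have : IsFiniteMeasure (volume.restrict B) :=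
    ⟨by rw [Measure.restrict_apply_univ]; exact measure_ball_lt_top⟩
  have hwB : MemLp w (ENNReal.ofReal p) (volume.restrict B) := hw.restrict B
  have hp1 : (1 : ENNReal) ≤ ENNReal.ofReal p := by
    rw [← ENNReal.ofReal_one]; exact ENNReal.ofReal_le_ofReal hp
  have hvol : volume B = ENNReal.ofReal (r ^ N * ω) := volume_ball_eq c hr
  have hreal : volume.real B = r ^ N * ω := by
    rw [Measure.real, hvol, ENNReal.toReal_ofReal (by positivity)]
  have hdiff : MemLp (fun y => w x - w y) (ENNReal.ofReal p) (volume.restrict B) :=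
    (memLp_const (w x)).sub hwB
  have hav : ⨍ y in B, (w x - w y) = w x - ⨍ y in B, w y := by
    have h0 : r ^ N * ω ≠ 0 := by positivity
    rw [setAverage_eq, setAverage_eq, integral_sub (integrable_const _) (hwB.integrable hp1),
      integral_const, measureReal_restrict_apply_univ, hreal]
    simp only [smul_eq_mul]; field_simp
  have h1 := abs_setAverage_rpow_le hp hr hdiff
  rw [hav] at h1
  set a := ⨍ y in B, w y
  have h2 : |w x| ^ p ≤ 2 ^ (p - 1) * |a| ^ p + 2 ^ (p - 1) * ⨍ y in B, |w x - w y| ^ p := by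
    have := abs_add_rpow_le a (w x - a) hp
    rw [add_sub_cancel] at this
    refine this.trans ?_
    rw [mul_add]; gcongr
  refine (ENNReal.ofReal_le_ofReal h2).trans ?_
  rw [ENNReal.ofReal_add (by positivity) (mul_nonneg (by positivity)
    ((Real.rpow_nonneg (abs_nonneg _) _).trans h1))]
  gcongr
  rw [ENNReal.ofReal_mul (by positivity), ENNReal.ofReal_mul (by positivity), mul_assoc]
  gcongr
  rw [setAverage_eq, hreal, smul_eq_mul, ENNReal.ofReal_mul (by positivity),
    ofReal_integral_eq_lintegral_ofReal (MemLp.integrable_abs_rpow hp0 hdiff)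
      (Eventually.of_forall fun _ => Real.rpow_nonneg (abs_nonneg _) _),
    div_eq_inv_mul, ENNReal.ofReal_mul (by positivity), mul_assoc]
  gcongr
  rw [← lintegral_const_mul' _ _ ENNReal.ofReal_ne_top]
  refine (setLIntegral_mono' measurableSet_ball fun y hy => ?_).trans (setLIntegral_le_lintegral B _)
  rw [← ENNReal.ofReal_mul (by positivity)]
  refine ENNReal.ofReal_le_ofReal ?_
  rcases eq_or_ne x y with rfl | hxy
  · simp [Real.zero_rpow hp0.ne']
  have h3 : ‖x - y‖ ≤ 2 * r := by
    rw [← dist_eq_norm]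
    have := dist_triangle_right x y c
    rw [Metric.mem_ball] at hx hy
    linarith
  have h4 : 0 < ‖x - y‖ := norm_pos_iff.2 (sub_ne_zero.2 hxy)
  rw [mul_div_assoc', le_div_iff₀ (by positivity), mul_comm]
  gcongr

/-- The coefficient of the seminorm is of order `r^(sp)`. On a bounded family, fine covers therefore
reduce `L^p` smallness to smallness of the averages over the covering balls. -/
theorem setIntegral_abs_rpow_le (hp : 1 ≤ p) (hs : 0 < s) (hΩ : MeasurableSet Ω)
    (hΩf : volume Ω ≠ ⊤) {w : 𝔼 → ℝ}
    (hw : w ∈ W0 Ω s p) {D : Set 𝔼} {r δ : ℝ} (hr : 0 < r) (hδ : 0 ≤ δ)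
    (hD : Ω ⊆ ⋃ c ∈ D, Metric.ball c r) (hδD : ∀ c ∈ D, |⨍ y in Metric.ball c r, w y| ≤ δ) :
    normPow Ω p w ≤ 2 ^ (p - 1) * δ ^ p * volume.real Ω +
      2 ^ (p - 1) * ((2 * r) ^ ((N : ℝ) + s * p) /
        (r ^ N * (volume (Metric.ball (0 : 𝔼) 1)).toReal)) * (gagliardoPow N s p w).toReal := by
  have hp0 : 0 < p := by linarith
  have hω0 : 0 < (volume (Metric.ball (0 : 𝔼) 1)).toReal := volume_unitBall_pos
  set K := 2 ^ (p - 1) * ((2 * r) ^ ((N : ℝ) + s * p) /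
        (r ^ N * (volume (Metric.ball (0 : 𝔼) 1)).toReal)) with hK
  have hK0 : 0 ≤ K := by positivity
  have h1 : ∫⁻ x in Ω, ENNReal.ofReal (|w x| ^ p) ≤
      ∫⁻ x in Ω, (ENNReal.ofReal (2 ^ (p - 1) * δ ^ p) + ENNReal.ofReal K *
        ∫⁻ y, ENNReal.ofReal (|w x - w y| ^ p / ‖x - y‖ ^ ((N : ℝ) + s * p))) := by
    refine setLIntegral_mono' hΩ fun x hx => ?_
    obtain ⟨c, hc, hxc⟩ := Set.mem_iUnion₂.1 (hD hx)
    refine (abs_rpow_le_average_add hp hs hw.1 hr hxc).trans ?_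
    gcongr
    exact hδD c hc
  have h2 : ∫⁻ x in Ω, (ENNReal.ofReal (2 ^ (p - 1) * δ ^ p) + ENNReal.ofReal K *
        ∫⁻ y, ENNReal.ofReal (|w x - w y| ^ p / ‖x - y‖ ^ ((N : ℝ) + s * p))) ≤
      ENNReal.ofReal (2 ^ (p - 1) * δ ^ p * volume.real Ω + K * (gagliardoPow N s p w).toReal) := by
    rw [lintegral_add_left measurable_const, lintegral_const_mul' _ _ ENNReal.ofReal_ne_top,
      lintegral_const, Measure.restrict_apply_univ, ENNReal.ofReal_add (by positivity) (by positivity),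
      ENNReal.ofReal_mul (q := volume.real Ω) (by positivity), ENNReal.ofReal_mul hK0,
      ENNReal.ofReal_toReal hw.2.1.ne, Measure.real, ENNReal.ofReal_toReal hΩf]
    gcongr
    exact setLIntegral_le_lintegral _ _
  rw [normPow, integral_eq_lintegral_of_nonneg_ae
    (Eventually.of_forall fun _ => Real.rpow_nonneg (abs_nonneg _) _)
    (aestronglyMeasurable_abs_rpow hw.1.1.restrict p)]
  exact ENNReal.toReal_le_of_le_ofReal (by positivity) (h1.trans h2)

theorem gagliardoPow_sub_le (hp : 1 ≤ p) {u v : 𝔼 → ℝ} (hu : u ∈ W0 Ω s p) (hv : v ∈ W0 Ω s p) :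
    (gagliardoPow N s p (u - v)).toReal ≤
      2 ^ (p - 1) * ((gagliardoPow N s p u).toReal + (gagliardoPow N s p v).toReal) := by
  have hp0 : 0 < p := by linarith
  have hu' := MemLp.integrable_abs_rpow hp0 (W0.memLp_diffQuot hp0 hu)
  have hv' := MemLp.integrable_abs_rpow hp0 (W0.memLp_diffQuot hp0 hv)
  rw [toReal_gagliardoPow hp0.ne' hu.1.1, toReal_gagliardoPow hp0.ne' hv.1.1,
    toReal_gagliardoPow hp0.ne' (W0.sub_mem hp0 hu hv).1.1, ← integral_add hu' hv',
    ← integral_const_mul]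
  refine integral_mono
    (MemLp.integrable_abs_rpow hp0 (W0.memLp_diffQuot hp0 (W0.sub_mem hp0 hu hv)))
    ((hu'.add hv').const_mul _) fun z => ?_
  have h := abs_add_rpow_le (diffQuot s p u z) (-diffQuot s p v z) hp
  rw [abs_neg] at h
  refine le_trans (le_of_eq ?_) h
  simp only [diffQuot, Pi.sub_apply]
  congr 2; ring

theorem abs_setAverage_rpow_le_normPow (hp : 1 ≤ p) (hΩ : MeasurableSet Ω) {u : 𝔼 → ℝ}
    (hu : u ∈ W0 Ω s p) (c : 𝔼) {r : ℝ} (hr : 0 < r) :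
    |⨍ y in Metric.ball c r, u y| ^ p ≤ (volume.real (Metric.ball c r))⁻¹ * normPow Ω p u := by
  have hp0 : 0 < p := by linarith
  refine (abs_setAverage_rpow_le hp hr (hu.1.restrict _)).trans ?_
  rw [setAverage_eq, smul_eq_mul, normPow_eq hp0.ne' hΩ hu]
  refine mul_le_mul_of_nonneg_left ?_ (by positivity)
  exact setIntegral_le_integral (MemLp.integrable_abs_rpow hp0 hu.1)
    (Eventually.of_forall fun _ => Real.rpow_nonneg (abs_nonneg _) _)

/-- Countably many averages converge simultaneously along a subsequence. -/
theorem exists_subseq_tendsto_average (hp : 1 ≤ p) (hΩ : MeasurableSet Ω) {ι : Type*} [Countable ι]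
    (c : ι → 𝔼) (r : ι → ℝ) (hr : ∀ i, 0 < r i) {u : ℕ → 𝔼 → ℝ} (hu : ∀ n, u n ∈ W0 Ω s p)
    {M : ℝ} (hM : ∀ n, normPow Ω p (u n) ≤ M) :
    ∃ φ : ℕ → ℕ, StrictMono φ ∧ ∃ a : ι → ℝ, ∀ i,
      Tendsto (fun n => ⨍ y in Metric.ball (c i) (r i), u (φ n) y) atTop (𝓝 (a i)) := by
  have hp0 : 0 < p := by linarith
  set b : ι → ℝ := fun i => ((volume.real (Metric.ball (c i) (r i)))⁻¹ * M) ^ p⁻¹ with hb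
  have hmem : ∀ n, (fun i => ⨍ y in Metric.ball (c i) (r i), u n y) ∈
      Set.univ.pi fun i => Set.Icc (-b i) (b i) := fun n i _ => by
    rw [Set.mem_Icc, ← abs_le, hb]
    have h := (abs_setAverage_rpow_le_normPow hp hΩ (hu n) (c i) (hr i)).trans
      (mul_le_mul_of_nonneg_left (hM n) (by positivity))
    rw [Real.le_rpow_inv_iff_of_pos (abs_nonneg _)
      ((Real.rpow_nonneg (abs_nonneg _) _).trans h) hp0]
    exact h
  -- A countable product of compact intervals is sequentially compact, which replaces a diagonal
  -- argument.
  obtain ⟨a, -, φ, hφ, hlim⟩ := (isCompact_univ_pi fun i => isCompact_Icc).tendsto_subseq hmem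
  exact ⟨φ, hφ, a, fun i => (tendsto_pi_nhds.1 hlim) i⟩

/-- One subsequence makes all averages converge, over finite covers at every scale `1/(k + 1)`.
Given `ε`, the scale makes the seminorm contribution to `u n - u m` small, and then finitely many
Cauchy conditions control the averages. -/
theorem exists_subseq_cauchy (hp : 1 ≤ p) (hs : 0 < s) (hΩ : MeasurableSet Ω)
    (hΩb : Bornology.IsBounded Ω) {u : ℕ → 𝔼 → ℝ} (hu : ∀ n, u n ∈ W0 Ω s p) {M G : ℝ}
    (hM : ∀ n, normPow Ω p (u n) ≤ M) (hG : ∀ n, (gagliardoPow N s p (u n)).toReal ≤ G) :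
    ∃ φ : ℕ → ℕ, StrictMono φ ∧ ∀ ε > 0, ∃ n₀, ∀ n ≥ n₀, ∀ m ≥ n₀,
      normPow Ω p (u (φ n) - u (φ m)) < ε := by
  have hp0 : 0 < p := by linarith
  have htb : TotallyBounded Ω := hΩb.isCompact_closure.totallyBounded.subset subset_closure
  have hcov : ∀ k : ℕ, ∃ t : Set 𝔼, t.Finite ∧ Ω ⊆ ⋃ y ∈ t, Metric.ball y (1 / ((k : ℝ) + 1)) :=
    fun k => Metric.totallyBounded_iff.1 htb _ Nat.one_div_pos_of_nat
  choose t htf htc using hcov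
  have : ∀ k, Countable (t k) := fun k => (htf k).countable
  obtain ⟨φ, hφ, a, ha⟩ := exists_subseq_tendsto_average (ι := Σ k, t k) hp hΩ
    (fun i => (i.2 : 𝔼)) (fun i => 1 / ((i.1 : ℝ) + 1)) (fun i => Nat.one_div_pos_of_nat) hu hM
  refine ⟨φ, hφ, fun ε hε => ?_⟩
  have hω0 : 0 < (volume (Metric.ball (0 : 𝔼) 1)).toReal := volume_unitBall_pos
  set ω := (volume (Metric.ball (0 : 𝔼) 1)).toReal
  have hG0 : 0 ≤ G := ENNReal.toReal_nonneg.trans (hG 0)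
  set A := 2 ^ (p - 1) * (2 ^ ((N : ℝ) + s * p) / ω) * (2 ^ (p - 1) * (G + G)) with hA
  obtain ⟨k, hk⟩ : ∃ k : ℕ, A * (1 / ((k : ℝ) + 1)) ^ (s * p) < ε / 2 := by
    have h1 : Tendsto (fun k : ℕ => A * (1 / ((k : ℝ) + 1)) ^ (s * p)) atTop
        (𝓝 (A * 0 ^ (s * p))) :=
      ((tendsto_one_div_add_atTop_nhds_zero_nat (𝕜 := ℝ)).rpow_const
        (Or.inr (by positivity))).const_mul A
    rw [Real.zero_rpow (by positivity), mul_zero] at h1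
    exact (h1.eventually (gt_mem_nhds (half_pos hε))).exists
  obtain ⟨δ, hδ0, hδ⟩ : ∃ δ : ℝ, 0 < δ ∧ 2 ^ (p - 1) * δ ^ p * volume.real Ω < ε / 2 := by
    have h1 : Tendsto (fun k : ℕ => 2 ^ (p - 1) * (1 / ((k : ℝ) + 1)) ^ p * volume.real Ω) atTop
        (𝓝 (2 ^ (p - 1) * 0 ^ p * volume.real Ω)) :=
      (((tendsto_one_div_add_atTop_nhds_zero_nat (𝕜 := ℝ)).rpow_const
        (Or.inr (by positivity))).const_mul _).mul_const _
    rw [Real.zero_rpow hp0.ne', mul_zero, zero_mul] at h1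
    obtain ⟨j, hj⟩ := (h1.eventually (gt_mem_nhds (half_pos hε))).exists
    exact ⟨_, Nat.one_div_pos_of_nat, hj⟩
  -- The limit `a` is indexed by pairs containing a membership proof; the equations on `i` express
  -- "the index of `c`" without naming that proof.
  have hev : ∀ᶠ n in atTop, ∀ c ∈ t k,
      ∀ i : Σ k, t k, i.1 = k → (i.2 : 𝔼) = c →
        |(⨍ y in Metric.ball c (1 / ((k : ℝ) + 1)), u (φ n) y) - a i| < δ / 2 := by
    rw [Filter.eventually_all_finite (htf k)]
    intro c hc
    have h1 := (ha ⟨k, ⟨c, hc⟩⟩).eventually (Metric.ball_mem_nhds _ (half_pos hδ0))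
    filter_upwards [h1] with n hn
    rintro ⟨k', c'⟩ hk' hc'
    simp only at hk' hc'
    subst hk'
    obtain rfl : c' = ⟨c, hc⟩ := Subtype.ext hc'
    rwa [Real.dist_eq] at hn
  obtain ⟨n₀, hn₀⟩ := eventually_atTop.1 hev
  refine ⟨n₀, fun n hn m hm => ?_⟩
  have hr : 0 < 1 / ((k : ℝ) + 1) := Nat.one_div_pos_of_nat
  have hΩf : volume Ω ≠ ⊤ := hΩb.measure_lt_top.ne
  refine lt_of_le_of_lt (setIntegral_abs_rpow_le hp hs hΩ hΩf
    (W0.sub_mem hp0 (hu (φ n)) (hu (φ m))) hr hδ0.le (htc k) fun c hc => ?_) ?_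
  · have hfin : IsFiniteMeasure (volume.restrict (Metric.ball c (1 / ((k : ℝ) + 1)))) :=
      ⟨by rw [Measure.restrict_apply_univ]; exact measure_ball_lt_top⟩
    have hp1 : (1 : ENNReal) ≤ ENNReal.ofReal p := by
      rw [← ENNReal.ofReal_one]; exact ENNReal.ofReal_le_ofReal hp
    have h1 := abs_lt.1 (hn₀ n hn c hc ⟨k, c, hc⟩ rfl rfl)
    have h2 := abs_lt.1 (hn₀ m hm c hc ⟨k, c, hc⟩ rfl rfl)
    have h3 : ⨍ y in Metric.ball c (1 / ((k : ℝ) + 1)), (u (φ n) - u (φ m)) y =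
        (⨍ y in Metric.ball c (1 / ((k : ℝ) + 1)), u (φ n) y) -
          ⨍ y in Metric.ball c (1 / ((k : ℝ) + 1)), u (φ m) y := by
      simp only [setAverage_eq, Pi.sub_apply]
      rw [integral_sub (((hu (φ n)).1.restrict _).integrable hp1)
        (((hu (φ m)).1.restrict _).integrable hp1), smul_sub]
    rw [h3, abs_le]
    constructor <;> linarith
  · have hg := (gagliardoPow_sub_le hp (hu (φ n)) (hu (φ m))).trans
      (mul_le_mul_of_nonneg_left (add_le_add (hG _) (hG _)) (by positivity))
    set r := 1 / ((k : ℝ) + 1)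
    have e : 2 ^ (p - 1) * ((2 * r) ^ ((N : ℝ) + s * p) / (r ^ N * ω)) * (2 ^ (p - 1) * (G + G)) =
        A * r ^ (s * p) := by
      rw [hA, Real.mul_rpow two_pos.le hr.le, Real.rpow_add hr, Real.rpow_natCast]
      field_simp
    have := mul_le_mul_of_nonneg_left hg (show 0 ≤ 2 ^ (p - 1) *
      ((2 * r) ^ ((N : ℝ) + s * p) / (r ^ N * ω)) by positivity)
    linarith

theorem norm_toLp_rpow (hp : 1 ≤ p) {w : 𝔼 → ℝ} (hw : MemLp w (ENNReal.ofReal p) volume) :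
    ‖hw.toLp w‖ ^ p = ∫ x, |w x| ^ p := by
  have hp0 : 0 < p := by linarith
  have h0 : 0 ≤ ∫ x, |w x| ^ p := integral_nonneg fun _ => Real.rpow_nonneg (abs_nonneg _) _
  rw [Lp.norm_toLp, hw.eLpNorm_eq_integral_rpow_norm (by simpa using hp0) ENNReal.ofReal_ne_top,
    ENNReal.toReal_ofReal (by positivity), ENNReal.toReal_ofReal hp0.le]
  simp only [Real.norm_eq_abs]
  rw [← Real.rpow_mul h0, inv_mul_cancel₀ hp0.ne', Real.rpow_one]

theorem ae_prod_of_ae {P : 𝔼 → Prop} (h : ∀ᵐ x, P x) :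
    ∀ᵐ z ∂((volume : Measure 𝔼).prod (volume : Measure 𝔼)), P z.1 ∧ P z.2 :=
  (Measure.quasiMeasurePreserving_fst.ae h).and (Measure.quasiMeasurePreserving_snd.ae h)

theorem tendsto_diffQuot {u : ℕ → 𝔼 → ℝ} {v : 𝔼 → ℝ}
    (h : ∀ᵐ x, Tendsto (fun n => u n x) atTop (𝓝 (v x))) :
    ∀ᵐ z ∂((volume : Measure 𝔼).prod (volume : Measure 𝔼)),
      Tendsto (fun n => diffQuot s p (u n) z) atTop (𝓝 (diffQuot s p v z)) := by
  filter_upwards [ae_prod_of_ae h] with z hz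
  exact (hz.1.sub hz.2).div_const _

/-- Fatou is applied to the extended-valued integral, because finiteness of the seminorm of the
limit is part of the claim. -/
theorem W0.mem_of_tendsto (hp : 0 < p) {u : ℕ → 𝔼 → ℝ} (hu : ∀ n, u n ∈ W0 Ω s p) {G : ℝ}
    (hG : ∀ n, (gagliardoPow N s p (u n)).toReal ≤ G) {v : 𝔼 → ℝ}
    (hv : MemLp v (ENNReal.ofReal p) volume)
    (h : ∀ᵐ x, Tendsto (fun n => u n x) atTop (𝓝 (v x))) : v ∈ W0 Ω s p := by
  refine ⟨hv, ?_, ?_⟩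
  · refine lt_of_le_of_lt ?_ (ENNReal.ofReal_lt_top (r := G))
    rw [gagliardoPow_eq hp.ne' hv.1]
    refine le_trans (lintegral_mono_ae ?_) ((lintegral_liminf_le' (u := atTop) fun n =>
      (aestronglyMeasurable_abs_rpow (aestronglyMeasurable_diffQuot (s := s) (p := p)
        (hu n).1.1) p).aemeasurable.ennreal_ofReal).trans ?_)
    · filter_upwards [tendsto_diffQuot (s := s) (p := p) h] with z hz
      exact (ENNReal.tendsto_ofReal (hz.abs.rpow_const (Or.inr hp.le))).liminf_eq.ge
    · refine liminf_le_of_le (by isBoundedDefault) fun b hb => ?_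
      obtain ⟨n, hn⟩ := hb.exists
      refine hn.trans ?_
      rw [← gagliardoPow_eq hp.ne' (hu n).1.1]
      exact ENNReal.le_ofReal_iff_toReal_le (hu n).2.1.ne
        (ENNReal.toReal_nonneg.trans (hG n)) |>.2 (hG n)
  · filter_upwards [h, ae_all_iff.2 fun n => (hu n).2.2] with x hx h0 hxΩ
    refine tendsto_nhds_unique hx ?_
    simp [h0 _ hxΩ]

/-- Bounded sequences in `W_0^{s,p}(Ω)` have subsequences that converge in `L^p` and almost
everywhere. -/
theorem exists_subseq_tendsto (hp : 1 ≤ p) (hs : 0 < s) (hΩ : MeasurableSet Ω)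
    (hΩb : Bornology.IsBounded Ω) {u : ℕ → 𝔼 → ℝ} (hu : ∀ n, u n ∈ W0 Ω s p) {M G : ℝ}
    (hM : ∀ n, normPow Ω p (u n) ≤ M) (hG : ∀ n, (gagliardoPow N s p (u n)).toReal ≤ G) :
    ∃ φ : ℕ → ℕ, StrictMono φ ∧ ∃ v ∈ W0 Ω s p,
      (∀ᵐ x, Tendsto (fun n => u (φ n) x) atTop (𝓝 (v x))) ∧
      Tendsto (fun n => normPow Ω p (u (φ n))) atTop (𝓝 (normPow Ω p v)) := by
  have hp0 : 0 < p := by linarith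
  have hfact : Fact (1 ≤ ENNReal.ofReal p) :=
    ⟨by rw [← ENNReal.ofReal_one]; exact ENNReal.ofReal_le_ofReal hp⟩
  obtain ⟨φ, hφ, hc⟩ := exists_subseq_cauchy hp hs hΩ hΩb hu hM hG
  have hcau : CauchySeq fun n => (hu (φ n)).1.toLp (u (φ n)) := by
    refine Metric.cauchySeq_iff.2 fun ε hε => ?_
    obtain ⟨n₀, h⟩ := hc (ε ^ p) (by positivity)
    refine ⟨n₀, fun n hn m hm => ?_⟩
    have h1 := h n hn m hm
    have hsub := W0.sub_mem hp0 (hu (φ n)) (hu (φ m))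
    rw [normPow_eq hp0.ne' hΩ hsub, ← norm_toLp_rpow hp hsub.1,
      Real.rpow_lt_rpow_iff (norm_nonneg _) hε.le hp0, MemLp.toLp_sub (hu (φ n)).1 (hu (φ m)).1] at h1
    rwa [dist_eq_norm]
  obtain ⟨g, hg⟩ := cauchySeq_tendsto_of_complete hcau
  obtain ⟨ψ, hψ, hae⟩ := (tendstoInMeasure_of_tendsto_Lp hg).exists_seq_tendsto_ae
  have hae' : ∀ᵐ x, Tendsto (fun n => u (φ (ψ n)) x) atTop (𝓝 (g x)) := by
    filter_upwards [hae, ae_all_iff.2 fun n => (hu (φ (ψ n))).1.coeFn_toLp] with x hx h1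
    exact hx.congr h1
  have hgW : (g : 𝔼 → ℝ) ∈ W0 Ω s p :=
    W0.mem_of_tendsto hp0 (fun n => hu (φ (ψ n))) (fun n => hG _) (Lp.memLp g) hae'
  refine ⟨φ ∘ ψ, hφ.comp hψ, g, hgW, hae', ?_⟩
  have h1 := ((hg.comp hψ.tendsto_atTop).norm).rpow_const (p := p) (Or.inr hp0.le)
  have h2 : ‖g‖ ^ p = normPow Ω p g := by
    rw [normPow_eq hp0.ne' hΩ hgW, ← norm_toLp_rpow hp hgW.1, Lp.toLp_coeFn]
  rw [h2] at h1
  refine h1.congr fun n => ?_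
  rw [normPow_eq hp0.ne' hΩ (hu _), ← norm_toLp_rpow hp (hu _).1]
  rfl

theorem eventually_gagliardoPow_le (hp : 0 < p) {u : ℕ → 𝔼 → ℝ} (hu : ∀ n, u n ∈ W0 Ω s p)
    {v : 𝔼 → ℝ} (hv : v ∈ W0 Ω s p) (h : ∀ᵐ x, Tendsto (fun n => u n x) atTop (𝓝 (v x)))
    {ε : ℝ} (hε : 0 < ε) :
    ∀ᶠ n in atTop, (gagliardoPow N s p v).toReal ≤ (gagliardoPow N s p (u n)).toReal + ε := by
  have e := fun n => toReal_gagliardoPow (s := s) hp.ne' (hu n).1.1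
  simp only [e, toReal_gagliardoPow hp.ne' hv.1.1]
  refine eventually_integral_le_add_of_tendsto
    (fun n => MemLp.integrable_abs_rpow hp (W0.memLp_diffQuot hp (hu n)))
    (fun n z => Real.rpow_nonneg (abs_nonneg _) _)
    (MemLp.integrable_abs_rpow hp (W0.memLp_diffQuot hp hv)) ?_ hε
  filter_upwards [tendsto_diffQuot (s := s) (p := p) h] with z hz
  exact hz.abs.rpow_const (Or.inr hp.le)

/-! ### Scaling along rays and the minimax formula -/

theorem isFiniteMeasure_restrict_of_isBounded (hΩb : Bornology.IsBounded Ω) :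
    IsFiniteMeasure (volume.restrict Ω) :=
  ⟨by rw [Measure.restrict_apply_univ]; exact hΩb.measure_lt_top⟩

theorem W0.memLp_gagliardoNirenberg (hN : 0 < N) (hs : 0 < s) (hp : 0 < p) {u : 𝔼 → ℝ}
    (hu : u ∈ W0 Ω s p) : MemLp u (ENNReal.ofReal (p + s * p / N * p)) volume := by
  have hnn : ∀ x, 0 ≤ |u x| ^ p := fun _ => Real.rpow_nonneg (abs_nonneg _) _
  rcases (integral_nonneg (μ := volume) (f := fun x => |u x| ^ p) hnn).eq_or_lt with h | h
  · rw [eq_comm, integral_eq_zero_iff_of_nonneg hnn (MemLp.integrable_abs_rpow hp hu.1)] at h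
    refine (MemLp.zero (ε := ℝ)).ae_eq ?_
    filter_upwards [h] with x hx
    have hx : |u x| ^ p = 0 := hx
    exact (abs_eq_zero.1 ((Real.rpow_eq_zero (abs_nonneg _) hp.ne').1 hx)).symm
  · exact ((exists_gagliardo_nirenberg hN hs hp).choose_spec.2 u hu h).1

theorem W0.integrableOn_abs_rpow (hp : 0 < p) {u : 𝔼 → ℝ} (hu : u ∈ W0 Ω s p) :
    IntegrableOn (fun x => |u x| ^ p) Ω :=
  MemLp.integrable_abs_rpow hp (hu.1.restrict Ω)

theorem W0.integrableOn_abs_rpow_mul_log (hN : 0 < N) (hs : 0 < s) (hp : 1 ≤ p)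
    (hΩb : Bornology.IsBounded Ω) {u : 𝔼 → ℝ} (hu : u ∈ W0 Ω s p) :
    IntegrableOn (fun x => |u x| ^ p * Real.log |u x|) Ω := by
  have := isFiniteMeasure_restrict_of_isBounded hΩb
  have hN' : (0 : ℝ) < N := by exact_mod_cast hN
  have hp0 : 0 < p := by linarith
  exact integrable_abs_rpow_mul_log hp (κ := s * p / N * p) (by positivity)
    ((W0.memLp_gagliardoNirenberg hN hs hp0 hu).restrict Ω)

theorem logTerm_smul (hN : 0 < N) (hs : 0 < s) (hp : 1 ≤ p) (hΩb : Bornology.IsBounded Ω)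
    {u : 𝔼 → ℝ} (hu : u ∈ W0 Ω s p) {l : ℝ} (hl : 0 < l) :
    logTerm Ω p (l • u) = l ^ p * (logTerm Ω p u + Real.log l * normPow Ω p u) := by
  have hp0 : 0 < p := by linarith
  rw [logTerm, logTerm, normPow, ← integral_const_mul, ← integral_add
    (W0.integrableOn_abs_rpow_mul_log hN hs hp hΩb hu)
    ((W0.integrableOn_abs_rpow hp0 hu).const_mul _), ← integral_const_mul]
  congr 1 with x
  rw [Pi.smul_apply, smul_eq_mul, abs_mul, abs_of_pos hl]
  rcases eq_or_ne (u x) 0 with h | h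
  · simp [h, Real.zero_rpow hp0.ne']
  · rw [Real.mul_rpow hl.le (abs_nonneg _), Real.log_mul hl.ne' (abs_ne_zero.2 h)]; ring

theorem X0.smul_mem (hp : 0 < p) {u : 𝔼 → ℝ} (hu : u ∈ X0 Ω s p) {l : ℝ} (hl : l ≠ 0) :
    l • u ∈ X0 Ω s p := by
  refine ⟨W0.smul_mem hp hu.1 l, fun h => hu.2 ?_⟩
  filter_upwards [h] with x hx
  simpa [hl] using hx

/-- `log |lu| = log l + log |u|` contributes the only term that is not homogeneous of degree `p`. -/
theorem nehariFunctional_smul (hN : 0 < N) (hs : 0 < s) (hp : 1 ≤ p)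
    (hΩb : Bornology.IsBounded Ω) {u : 𝔼 → ℝ} (hu : u ∈ W0 Ω s p) {l : ℝ} (hl : 0 < l) :
    nehariFunctional Ω s p (l • u) =
      l ^ p * (nehariFunctional Ω s p u - Real.log l * normPow Ω p u) := by
  rw [nehariFunctional, nehariFunctional, gagliardoPow_smul (by linarith) hu.1.1, normPow_smul,
    logTerm_smul hN hs hp hΩb hu hl, abs_of_pos hl]
  ring

theorem energy_eq (u : 𝔼 → ℝ) :
    energy Ω s p u = 1 / p * nehariFunctional Ω s p u + 1 / p ^ 2 * normPow Ω p u := by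
  rw [energy, nehariFunctional]; ring

/-- The maximum of the energy along the ray through `u`. -/
noncomputable def rayMax {N : ℕ} (Ω : Set (EuclideanSpace ℝ (Fin N))) (s p : ℝ)
    (u : EuclideanSpace ℝ (Fin N) → ℝ) : ℝ :=
  1 / p ^ 2 * (Real.exp (p * (nehariFunctional Ω s p u / normPow Ω p u)) * normPow Ω p u)

/-- The factor that projects `u` along its ray to the Nehari manifold. -/
noncomputable def rayScale {N : ℕ} (Ω : Set (EuclideanSpace ℝ (Fin N))) (s p : ℝ)
    (u : EuclideanSpace ℝ (Fin N) → ℝ) : ℝ :=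
  Real.exp (nehariFunctional Ω s p u / normPow Ω p u)

theorem rayScale_smul_mem_nehari (hN : 0 < N) (hs : 0 < s) (hp : 1 ≤ p) (hΩ : MeasurableSet Ω)
    (hΩb : Bornology.IsBounded Ω) {u : 𝔼 → ℝ} (hu : u ∈ X0 Ω s p) :
    rayScale Ω s p u • u ∈ nehari Ω s p := by
  have hp0 : 0 < p := by linarith
  have hm := normPow_pos hp0 hΩ hu
  refine ⟨X0.smul_mem hp0 hu (Real.exp_pos _).ne', ?_⟩
  rw [rayScale, nehariFunctional_smul hN hs hp hΩb hu.1 (Real.exp_pos _), Real.log_exp,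
    div_mul_cancel₀ _ hm.ne', sub_self, mul_zero]

theorem energy_of_mem_nehari {u : 𝔼 → ℝ} (hu : u ∈ nehari Ω s p) :
    energy Ω s p u = 1 / p ^ 2 * normPow Ω p u := by
  rw [energy_eq, hu.2]; ring

theorem rayMax_of_mem_nehari {u : 𝔼 → ℝ} (hu : u ∈ nehari Ω s p) :
    rayMax Ω s p u = energy Ω s p u := by
  rw [energy_of_mem_nehari hu, rayMax, hu.2]; simp

theorem energy_rayScale_smul (hN : 0 < N) (hs : 0 < s) (hp : 1 ≤ p) (hΩ : MeasurableSet Ω)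
    (hΩb : Bornology.IsBounded Ω) {u : 𝔼 → ℝ} (hu : u ∈ X0 Ω s p) :
    energy Ω s p (rayScale Ω s p u • u) = rayMax Ω s p u := by
  rw [energy_of_mem_nehari (rayScale_smul_mem_nehari hN hs hp hΩ hΩb hu), normPow_smul, rayMax,
    rayScale, abs_of_pos (Real.exp_pos _), ← Real.exp_mul, mul_comm p]

theorem energy_smul_le_rayMax (hN : 0 < N) (hs : 0 < s) (hp : 1 ≤ p) (hΩ : MeasurableSet Ω)
    (hΩb : Bornology.IsBounded Ω) {u : 𝔼 → ℝ} (hu : u ∈ X0 Ω s p) {l : ℝ} (hl : 0 < l) :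
    energy Ω s p (l • u) ≤ rayMax Ω s p u := by
  have hp0 : 0 < p := by linarith
  have hm := normPow_pos hp0 hΩ hu
  rw [energy_eq, nehariFunctional_smul hN hs hp hΩb hu.1 hl, normPow_smul, rayMax, abs_of_pos hl]
  set m := normPow Ω p u
  set I := nehariFunctional Ω s p u
  set k := Real.exp (p * (I / m)) with hk
  have hk0 : 0 < k := Real.exp_pos _
  -- Here `k` is the `p`-th power of the optimal scale. In terms of `y` the claim becomes `y (1 -
  -- log y) ≤ 1`, with equality at `y = 1`.
  set y := l ^ p / k with hy
  have hy0 : 0 < y := by positivity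
  have hlog : Real.log y = p * Real.log l - p * (I / m) := by
    rw [hy, Real.log_div (by positivity) hk0.ne', Real.log_rpow hl, hk, Real.log_exp]
  have hyk : l ^ p = y * k := by rw [hy]; field_simp
  have h1 := Real.one_sub_inv_le_log_of_pos hy0
  have h2 : y * (1 - Real.log y) ≤ 1 := by
    have := mul_le_mul_of_nonneg_left h1 hy0.le
    rw [mul_sub, mul_inv_cancel₀ hy0.ne'] at this
    linarith
  have e : 1 / p * (l ^ p * (I - Real.log l * m)) + 1 / p ^ 2 * (l ^ p * m) =
      1 / p ^ 2 * (k * m) * (y * (1 - Real.log y)) := by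
    rw [hyk, hlog]; field_simp; ring
  rw [e]
  exact mul_le_of_le_one_right (by positivity) h2

theorem energy_le_rayMax (hN : 0 < N) (hs : 0 < s) (hp : 1 ≤ p) (hΩ : MeasurableSet Ω)
    (hΩb : Bornology.IsBounded Ω) {u : 𝔼 → ℝ} (hu : u ∈ X0 Ω s p) :
    energy Ω s p u ≤ rayMax Ω s p u := by
  simpa using energy_smul_le_rayMax hN hs hp hΩ hΩb hu one_pos

theorem iSup_energy_smul (hN : 0 < N) (hs : 0 < s) (hp : 1 ≤ p) (hΩ : MeasurableSet Ω)
    (hΩb : Bornology.IsBounded Ω) {u : 𝔼 → ℝ} (hu : u ∈ X0 Ω s p) :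
    ⨆ (l : ℝ) (_ : 0 < l), (energy Ω s p (l • u) : EReal) = (rayMax Ω s p u : EReal) := by
  refine le_antisymm (iSup₂_le fun l hl => ?_) ?_
  · exact_mod_cast energy_smul_le_rayMax hN hs hp hΩ hΩb hu hl
  · rw [← energy_rayScale_smul hN hs hp hΩ hΩb hu]
    exact le_iSup₂ (f := fun (l : ℝ) (_ : 0 < l) => (energy Ω s p (l • u) : EReal))
      (rayScale Ω s p u) (Real.exp_pos _)

/-- `rayMax u` is the energy of the projection of `u` to the Nehari manifold and agrees with the
energy on that manifold, so the constraint can be dropped. -/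
theorem depth_eq_iInf_rayMax (hN : 0 < N) (hs : 0 < s) (hp : 1 ≤ p) (hΩ : MeasurableSet Ω)
    (hΩb : Bornology.IsBounded Ω) : depth Ω s p = ⨅ u ∈ X0 Ω s p, (rayMax Ω s p u : EReal) := by
  refine le_antisymm (le_iInf₂ fun u hu => ?_) (le_iInf₂ fun u hu => ?_)
  · rw [← energy_rayScale_smul hN hs hp hΩ hΩb hu]
    exact iInf₂_le _ (rayScale_smul_mem_nehari hN hs hp hΩ hΩb hu)
  · rw [← rayMax_of_mem_nehari hu]
    exact iInf₂_le u hu.1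

theorem depth_eq_iInf_iSup (hN : 0 < N) (hs : 0 < s) (hp : 1 ≤ p) (hΩ : MeasurableSet Ω)
    (hΩb : Bornology.IsBounded Ω) : depth Ω s p =
      ⨅ u ∈ X0 Ω s p, ⨆ (l : ℝ) (_ : 0 < l), (energy Ω s p (l • u) : EReal) := by
  rw [depth_eq_iInf_rayMax hN hs hp hΩ hΩb]
  refine iInf_congr fun u => iInf_congr fun hu => ?_
  exact (iSup_energy_smul hN hs hp hΩ hΩb hu).symm

/-! ### The logarithmic estimate and the lower bound for the depth -/

/-- The logarithmic estimate on the unit sphere of `L^p`. -/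
theorem exists_logTerm_le_of_normPow_eq_one (hN : 0 < N) (hs : 0 < s) (hp : 1 ≤ p)
    (hΩ : MeasurableSet Ω) (hΩb : Bornology.IsBounded Ω) :
    ∃ C : ℝ, 0 < C ∧ ∀ u ∈ W0 Ω s p, normPow Ω p u = 1 →
      logTerm Ω p u ≤ 1 / 2 * (gagliardoPow N s p u).toReal + C := by
  have hN' : (0 : ℝ) < N := by exact_mod_cast hN
  have hp0 : 0 < p := by linarith
  obtain ⟨c, hc, hGN⟩ := exists_gagliardo_nirenberg (Ω := Ω) hN hs hp0
  -- With `η = 1/(2c)` the Gagliardo–Nirenberg constant cancels and leaves `1/2`.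
  have hη : 0 < 1 / (2 * c) := by positivity
  have hκ : 0 < s * p / N * p := by positivity
  obtain ⟨C, hC, hlog⟩ := exists_rpow_mul_log_le hp0 hκ hη
  refine ⟨C, hC, fun u hu hm => ?_⟩
  have hm' := hm
  rw [normPow_eq hp0.ne' hΩ hu] at hm'
  obtain ⟨hLq, hq⟩ := hGN u hu (by rw [hm']; exact one_pos)
  rw [hm', Real.one_rpow, mul_one] at hq
  have hqi := MemLp.integrable_abs_rpow (by positivity) hLq
  have h1 : logTerm Ω p u ≤
      1 / (2 * c) * (∫ x in Ω, |u x| ^ (p + s * p / N * p)) + C * normPow Ω p u := by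
    rw [normPow, ← integral_const_mul, ← integral_const_mul, ← integral_add
      (hqi.integrableOn.const_mul _) ((W0.integrableOn_abs_rpow hp0 hu).const_mul _)]
    exact integral_mono (W0.integrableOn_abs_rpow_mul_log hN hs hp hΩb hu)
      ((hqi.integrableOn.const_mul _).add ((W0.integrableOn_abs_rpow hp0 hu).const_mul _))
      fun x => hlog (u x)
  have h2 : ∫ x in Ω, |u x| ^ (p + s * p / N * p) ≤ c * (gagliardoPow N s p u).toReal :=
    (setIntegral_le_integral hqi
      (Eventually.of_forall fun _ => Real.rpow_nonneg (abs_nonneg _) _)).trans hq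
  rw [hm, mul_one] at h1
  have h3 := mul_le_mul_of_nonneg_left h2 hη.le
  have e : 1 / (2 * c) * (c * (gagliardoPow N s p u).toReal) =
    1 / 2 * (gagliardoPow N s p u).toReal := by field_simp
  linarith

theorem normPow_normalize (hp : 0 < p) (hΩ : MeasurableSet Ω) {u : 𝔼 → ℝ} (hu : u ∈ X0 Ω s p) :
    normPow Ω p ((normPow Ω p u ^ (-p⁻¹)) • u) = 1 := by
  have hm := normPow_pos hp hΩ hu
  rw [normPow_smul, abs_of_pos (by positivity), ← Real.rpow_mul hm.le, neg_mul,
    inv_mul_cancel₀ hp.ne', Real.rpow_neg_one, inv_mul_cancel₀ hm.ne']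

theorem exists_logEstimate (hN : 0 < N) (hs : 0 < s) (hp : 1 ≤ p) (hΩ : MeasurableSet Ω)
    (hΩb : Bornology.IsBounded Ω) {γ : ℝ} (hγ : 1 < γ) :
    ∃ C : ℝ, LogEstimate Ω s p (1 / 2) γ C := by
  have hp0 : 0 < p := by linarith
  obtain ⟨C, hC, h⟩ := exists_logTerm_le_of_normPow_eq_one (Ω := Ω) hN hs hp hΩ hΩb
  have hγ0 : 0 < γ - 1 := by linarith
  -- Rescaling from the sphere adds `(m/p) log m` to `C m`. The sum is `(m/p) log(e^(pC) m)`, and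
  -- `log x ≤ x^(γ-1) / (γ-1)` gives this constant.
  refine ⟨1 / p * (Real.exp (p * C) ^ (γ - 1) / (γ - 1)), by positivity, fun u hu => ?_⟩
  have hm := normPow_pos hp0 hΩ hu
  have h1 := h _ (W0.smul_mem hp0 hu.1 _) (normPow_normalize hp0 hΩ hu)
  rw [logTerm_smul hN hs hp hΩb hu.1 (by positivity), gagliardoPow_smul hp0.ne' hu.1.1.1] at h1
  set m := normPow Ω p u
  set g := (gagliardoPow N s p u).toReal
  set L := logTerm Ω p u
  rw [abs_of_pos (by positivity), ← Real.rpow_mul hm.le, neg_mul, inv_mul_cancel₀ hp0.ne',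
    Real.rpow_neg_one, Real.log_rpow hm] at h1
  have h2 := Real.log_le_rpow_div (show 0 ≤ Real.exp (p * C) * m by positivity) hγ0
  rw [Real.log_mul (Real.exp_pos _).ne' hm.ne', Real.log_exp,
    Real.mul_rpow (Real.exp_pos _).le hm.le] at h2
  have h3 : L + -p⁻¹ * Real.log m * m ≤ 1 / 2 * g + C * m := by
    have := mul_le_mul_of_nonneg_left h1 hm.le
    calc L + -p⁻¹ * Real.log m * m = m * (m⁻¹ * (L + -p⁻¹ * Real.log m * m)) := by field_simp
      _ ≤ _ := this
      _ = _ := by field_simp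
  have h4 := mul_le_mul_of_nonneg_left h2 (show 0 ≤ p⁻¹ * m by positivity)
  have e1 : p⁻¹ * m * (p * C + Real.log m) = C * m + p⁻¹ * Real.log m * m := by field_simp
  have e2 : p⁻¹ * m * (Real.exp (p * C) ^ (γ - 1) * m ^ (γ - 1) / (γ - 1)) =
      1 / p * (Real.exp (p * C) ^ (γ - 1) / (γ - 1)) * m ^ γ := by
    have : m ^ γ = m ^ (γ - 1) * m := by rw [← Real.rpow_add_one hm.ne']; congr 1; ring
    rw [this]; ring
  linarith

/-- On the Nehari manifold `[u]^p + m` equals the logarithmic term, so the estimate leaves `m ≤ C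
m^γ`. Thus `m ≥ (1/C)^(1/(γ-1)) = R^p`, and the energy there is `m/p²`. -/
theorem le_depth_of_logEstimate (hp : 1 ≤ p) (hΩ : MeasurableSet Ω) {γ C : ℝ} (hγ : 1 < γ)
    (hC : LogEstimate Ω s p (1 / 2) γ C) :
    0 < radius p γ C ^ p / p ^ 2 ∧ ((radius p γ C ^ p / p ^ 2 : ℝ) : EReal) ≤ depth Ω s p := by
  have hp0 : 0 < p := by linarith
  have hγ0 : 0 < γ - 1 := by linarith
  obtain ⟨hC0, hC⟩ := hC
  have hR : radius p γ C ^ p = (1 / C) ^ (γ - 1)⁻¹ := by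
    rw [radius, ← Real.rpow_mul (by positivity)]; congr 1; field_simp
  rw [hR]
  refine ⟨by positivity, le_iInf₂ fun u hu => ?_⟩
  have hm := normPow_pos hp0 hΩ hu.1
  have h1 := hC u hu.1
  have h2 := hu.2
  rw [nehariFunctional] at h2
  have hg : 0 ≤ (gagliardoPow N s p u).toReal := ENNReal.toReal_nonneg
  rw [energy_of_mem_nehari hu]
  set m := normPow Ω p u
  have e : m ^ γ = m ^ (γ - 1) * m := by rw [← Real.rpow_add_one hm.ne']; congr 1; ring
  have h3 : 1 * m ≤ (C * m ^ (γ - 1)) * m := by rw [e] at h1; linarith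
  have h4 : 1 / C ≤ m ^ (γ - 1) := by
    rw [div_le_iff₀ hC0, mul_comm]; exact le_of_mul_le_mul_right h3 hm
  have h5 : (1 / C) ^ (γ - 1)⁻¹ ≤ m := by
    rw [Real.rpow_inv_le_iff_of_pos (by positivity) hm.le hγ0]; exact h4
  have h6 : (1 / C) ^ (γ - 1)⁻¹ / p ^ 2 ≤ 1 / p ^ 2 * m := by
    rw [div_eq_inv_mul, one_div (p ^ 2)]; gcongr
  exact_mod_cast h6

/-- The interpolation identity amounts to `θ (p + ϱ) = Nϱ/(sp)`. The upper bound on `ϱ` makes the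
denominator of `γ` positive, and the numerator exceeds it by `ϱ`. -/
theorem one_lt_interpolation_exponent (hN : s * p < N) (hs : 0 < s) (hp : 0 < p) {ϱ θ γ : ℝ}
    (hϱ : 0 < ϱ) (hϱ' : ϱ < s * p ^ 2 / N)
    (hθ : 1 / (p + ϱ) = (1 - θ) / p + θ / (N * p / (N - s * p)))
    (hγ : γ = (1 - θ) * (p + ϱ) / (p - θ * (p + ϱ))) : 1 < γ := by
  have hN0 : (0 : ℝ) < N := lt_of_le_of_lt (by positivity) hN
  have hd : (0 : ℝ) < N - s * p := by linarith
  have h1 : θ * (p + ϱ) = N * ϱ / (s * p) := by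
    field_simp at hθ ⊢
    linarith
  have h2 : N * ϱ / (s * p) < p := by
    rw [lt_div_iff₀ hN0] at hϱ'
    rw [div_lt_iff₀ (by positivity)]; linarith
  rw [hγ, h1, one_lt_div (by linarith), sub_mul, one_mul, h1]
  linarith

/-! ### Existence of a minimizer -/

/-- Upper semicontinuity of the logarithmic term along sequences that are bounded in
`W_0^{s,p}(Ω)`, normalized in `L^p`, and converge almost everywhere. -/
theorem eventually_logTerm_le (hN : 0 < N) (hs : 0 < s) (hp : 1 ≤ p) (hΩ : MeasurableSet Ω)
    (hΩb : Bornology.IsBounded Ω) {u : ℕ → 𝔼 → ℝ} (hu : ∀ n, u n ∈ W0 Ω s p)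
    (hm : ∀ n, normPow Ω p (u n) = 1) {G : ℝ} (hG : ∀ n, (gagliardoPow N s p (u n)).toReal ≤ G)
    {v : 𝔼 → ℝ} (hv : v ∈ W0 Ω s p) (hmv : normPow Ω p v = 1)
    (h : ∀ᵐ x, Tendsto (fun n => u n x) atTop (𝓝 (v x))) {ε : ℝ} (hε : 0 < ε) :
    ∀ᶠ n in atTop, logTerm Ω p (u n) ≤ logTerm Ω p v + ε := by
  have hN' : (0 : ℝ) < N := by exact_mod_cast hN
  have hp0 : 0 < p := by linarith
  have hκ : 0 < s * p / N * p := by positivity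
  set q := p + s * p / N * p with hq
  have hq0 : 0 < q := by positivity
  obtain ⟨c, hc, hGN⟩ := exists_gagliardo_nirenberg (Ω := Ω) hN hs hp0
  have hG0 : 0 ≤ G := ENNReal.toReal_nonneg.trans (hG 0)
  -- This makes `η ∫|u n|^q ≤ ε/2` uniformly in `n`; the summand `1` keeps the denominator positive.
  set η := ε / 2 / (c * G + 1) with hη
  have hη0 : 0 < η := by positivity
  obtain ⟨C, hC, hlog⟩ := exists_rpow_mul_log_le hp0 hκ hη0
  have hqint : ∀ {w : 𝔼 → ℝ}, w ∈ W0 Ω s p → IntegrableOn (fun x => |w x| ^ q) Ω := fun hw =>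
    MemLp.integrable_abs_rpow hq0 ((W0.memLp_gagliardoNirenberg hN hs hp0 hw).restrict Ω)
  have hF : ∀ {w : 𝔼 → ℝ}, w ∈ W0 Ω s p → IntegrableOn (fun x => η * |w x| ^ q + C * |w x| ^ p -
      |w x| ^ p * Real.log |w x|) Ω := fun hw =>
    (((hqint hw).const_mul η).add ((W0.integrableOn_abs_rpow hp0 hw).const_mul C)).sub
      (W0.integrableOn_abs_rpow_mul_log hN hs hp hΩb hw)
  have hint : ∀ {w : 𝔼 → ℝ}, w ∈ W0 Ω s p → ∫ x in Ω, (η * |w x| ^ q + C * |w x| ^ p -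
      |w x| ^ p * Real.log |w x|) =
        η * (∫ x in Ω, |w x| ^ q) + C * normPow Ω p w - logTerm Ω p w := by
    intro w hw
    have hA : IntegrableOn (fun x => η * |w x| ^ q + C * |w x| ^ p) Ω :=
      ((hqint hw).const_mul η).add ((W0.integrableOn_abs_rpow hp0 hw).const_mul C)
    rw [integral_sub hA
      (W0.integrableOn_abs_rpow_mul_log hN hs hp hΩb hw), integral_add ((hqint hw).const_mul η)
      ((W0.integrableOn_abs_rpow hp0 hw).const_mul C), integral_const_mul, integral_const_mul]
    rfl
  have hcont : Continuous fun t : ℝ => η * |t| ^ q + C * |t| ^ p - |t| ^ p * Real.log |t| := by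
    have h1 : Continuous fun t : ℝ => |t| ^ p * Real.log |t| := by
      have h2 : (fun t : ℝ => |t| ^ p * Real.log |t|) =
          fun t => |t| ^ (p - 1) * (|t| * Real.log |t|) := by
        funext t
        rcases (abs_nonneg t).eq_or_lt with h0 | h0
        · rw [← h0]; simp
        · rw [← mul_assoc, ← Real.rpow_add_one h0.ne', sub_add_cancel]
      rw [h2]
      exact (continuous_abs.rpow_const fun _ => Or.inr (by linarith)).mul
        (Real.continuous_mul_log.comp continuous_abs)
    exact (((continuous_abs.rpow_const fun _ => Or.inr hq0.le).const_mul η).add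
      ((continuous_abs.rpow_const fun _ => Or.inr hp0.le).const_mul C)).sub h1
  -- The two added powers make the negated logarithmic integrand nonnegative, so Fatou applies. The
  -- terms with `C` cancel because all norms are `1`.
  have hfatou := eventually_integral_le_add_of_tendsto (μ := volume.restrict Ω)
    (fun n => hF (hu n)) (fun n x => sub_nonneg.2 (hlog (u n x))) (hF hv)
    ((ae_restrict_of_ae h).mono fun x hx => (hcont.tendsto (v x)).comp hx) (half_pos hε)
  filter_upwards [hfatou] with n hn
  rw [hint hv, hint (hu n), hm n, hmv] at hn
  have h1 : 0 ≤ ∫ x in Ω, |v x| ^ q := integral_nonneg fun _ => Real.rpow_nonneg (abs_nonneg _) _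
  have h2 : ∫ x in Ω, |u n x| ^ q ≤ c * G := by
    have hm' := hm n
    rw [normPow_eq hp0.ne' hΩ (hu n)] at hm'
    obtain ⟨-, h3⟩ := hGN _ (hu n) (by rw [hm']; exact one_pos)
    rw [hm', Real.one_rpow, mul_one] at h3
    refine ((setIntegral_le_integral (MemLp.integrable_abs_rpow hq0
      (W0.memLp_gagliardoNirenberg hN hs hp0 (hu n)))
      (Eventually.of_forall fun _ => Real.rpow_nonneg (abs_nonneg _) _)).trans h3).trans ?_
    gcongr
    exact hG n
  have h4 : η * ∫ x in Ω, |u n x| ^ q ≤ ε / 2 := by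
    calc _ ≤ η * (c * G + 1) := by gcongr; linarith
      _ = _ := by rw [hη]; field_simp
  have h5 := mul_nonneg hη0.le h1
  linarith

/-- The Nehari functional attains its minimum on the unit sphere of `L^p`. -/
theorem exists_min_nehariFunctional (hN : 0 < N) (hs : 0 < s) (hp : 1 ≤ p) (hΩ : MeasurableSet Ω)
    (hΩb : Bornology.IsBounded Ω) (hne : (X0 Ω s p).Nonempty) :
    ∃ w ∈ W0 Ω s p, normPow Ω p w = 1 ∧ ∀ v ∈ W0 Ω s p, normPow Ω p v = 1 →
      nehariFunctional Ω s p w ≤ nehariFunctional Ω s p v := by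
  have hp0 : 0 < p := by linarith
  obtain ⟨C, hC, hlog⟩ := exists_logTerm_le_of_normPow_eq_one (Ω := Ω) hN hs hp hΩ hΩb
  set S := nehariFunctional Ω s p '' {v | v ∈ W0 Ω s p ∧ normPow Ω p v = 1} with hS
  -- Coercivity: half of the seminorm survives, so `I` is bounded below and minimizing sequences are
  -- bounded.
  have hlow : ∀ v ∈ W0 Ω s p, normPow Ω p v = 1 →
      1 / 2 * (gagliardoPow N s p v).toReal + 1 - C ≤ nehariFunctional Ω s p v := by
    intro v hv hm
    have := hlog v hv hm
    rw [nehariFunctional, hm]; linarith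
  have hSne : S.Nonempty := by
    obtain ⟨u, hu⟩ := hne
    exact ⟨_, _, ⟨W0.smul_mem hp0 hu.1 _, normPow_normalize hp0 hΩ hu⟩, rfl⟩
  have hSb : BddBelow S := by
    refine ⟨1 - C, ?_⟩
    rintro _ ⟨v, ⟨hv, hm⟩, rfl⟩
    have := hlow v hv hm
    have : 0 ≤ (gagliardoPow N s p v).toReal := ENNReal.toReal_nonneg
    linarith
  obtain ⟨a, hanti, hlim, ha⟩ := exists_seq_tendsto_sInf hSne hSb
  choose u hu hua using ha
  have hG : ∀ n, (gagliardoPow N s p (u n)).toReal ≤ 2 * (a 0 + C) := fun n => by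
    have h1 := hlow (u n) (hu n).1 (hu n).2
    have h2 := hanti (Nat.zero_le n)
    rw [hua n] at h1
    linarith
  obtain ⟨φ, hφ, w, hw, hae, hmw⟩ := exists_subseq_tendsto hp hs hΩ hΩb (fun n => (hu n).1)
    (fun n => (hu n).2.le) hG
  -- Strong `L^p` convergence keeps the limit on the sphere.
  have hmw1 : normPow Ω p w = 1 :=
    tendsto_nhds_unique hmw (tendsto_const_nhds.congr fun n => ((hu (φ n)).2).symm)
  refine ⟨w, hw, hmw1, fun v hv hm => ?_⟩
  refine le_trans ?_ (csInf_le hSb ⟨v, ⟨hv, hm⟩, rfl⟩)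
  refine le_of_forall_pos_le_add fun ε hε => ?_
  have h1 := eventually_gagliardoPow_le hp0 (fun n => (hu (φ n)).1) hw hae (half_pos (half_pos hε))
  have h2 := eventually_logTerm_le hN hs hp hΩ hΩb (fun n => (hu (φ n)).1) (fun n => (hu (φ n)).2)
    (fun n => hG (φ n)) hw hmw1 hae (half_pos (half_pos hε))
  have h3 := (hlim.comp hφ.tendsto_atTop).eventually
    (gt_mem_nhds (show sInf S < sInf S + ε / 2 by linarith))
  obtain ⟨n, hn1, hn2, hn3⟩ := (h1.and (h2.and h3)).exists
  have h4 : a (φ n) < sInf S + ε / 2 := hn3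
  rw [← hua, nehariFunctional, (hu (φ n)).2] at h4
  rw [nehariFunctional, hmw1]
  linarith

theorem rayMax_smul (hN : 0 < N) (hs : 0 < s) (hp : 1 ≤ p) (hΩ : MeasurableSet Ω)
    (hΩb : Bornology.IsBounded Ω) {u : 𝔼 → ℝ} (hu : u ∈ X0 Ω s p) {l : ℝ} (hl : 0 < l) :
    rayMax Ω s p (l • u) = rayMax Ω s p u := by
  have hm := normPow_pos (by linarith) hΩ hu
  have hlp : 0 < l ^ p := by positivity
  rw [rayMax, rayMax, nehariFunctional_smul hN hs hp hΩb hu.1 hl, normPow_smul, abs_of_pos hl,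
    mul_div_mul_left _ _ hlp.ne', sub_div, mul_div_cancel_right₀ _ hm.ne', mul_sub, Real.exp_sub,
    mul_comm p (Real.log l), ← Real.rpow_def_of_pos hl]
  field_simp

/-- The infimum defining the depth of the well is attained. -/
theorem exists_mem_nehari_forall_le_rayMax (hN : 0 < N) (hs : 0 < s) (hp : 1 ≤ p)
    (hΩ : MeasurableSet Ω) (hΩb : Bornology.IsBounded Ω) (hne : (X0 Ω s p).Nonempty) :
    ∃ u ∈ nehari Ω s p, ∀ v ∈ X0 Ω s p, energy Ω s p u ≤ rayMax Ω s p v := by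
  have hp0 : 0 < p := by linarith
  obtain ⟨w, hw, hmw, hmin⟩ := exists_min_nehariFunctional hN hs hp hΩ hΩb hne
  have hwX : w ∈ X0 Ω s p := mem_X0_of_normPow_pos hp0 hΩ hw (by rw [hmw]; exact one_pos)
  refine ⟨_, rayScale_smul_mem_nehari hN hs hp hΩ hΩb hwX, fun v hv => ?_⟩
  have hm := normPow_pos hp0 hΩ hv
  have hm1 := normPow_normalize hp0 hΩ hv
  -- Scale invariance moves `v` to the sphere, where `rayMax` is an increasing function of `I`.
  rw [energy_rayScale_smul hN hs hp hΩ hΩb hwX,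
    ← rayMax_smul hN hs hp hΩ hΩb hv (l := normPow Ω p v ^ (-p⁻¹)) (by positivity), rayMax, rayMax,
    hmw, hm1]
  gcongr
  exact hmin _ (W0.smul_mem hp0 hv.1 _) hm1

theorem energy_eq_depth (hN : 0 < N) (hs : 0 < s) (hp : 1 ≤ p) (hΩ : MeasurableSet Ω)
    (hΩb : Bornology.IsBounded Ω) {u : 𝔼 → ℝ} (hu : u ∈ nehari Ω s p)
    (hmin : ∀ v ∈ X0 Ω s p, energy Ω s p u ≤ rayMax Ω s p v) :
    (energy Ω s p u : EReal) = depth Ω s p := by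
  refine le_antisymm ?_ (iInf₂_le u hu)
  rw [depth_eq_iInf_rayMax hN hs hp hΩ hΩb]
  exact le_iInf₂ fun v hv => by exact_mod_cast hmin v hv

/-! ### First variation and the ground state -/

theorem hasDerivAt_logTerm (hN : 0 < N) (hs : 0 < s) (hp : 2 ≤ p)
    (hΩb : Bornology.IsBounded Ω) {u v : 𝔼 → ℝ} (hu : u ∈ W0 Ω s p) (hv : v ∈ W0 Ω s p) :
    HasDerivAt (fun t : ℝ => logTerm Ω p (u + t • v))
      (p * (∫ x in Ω, |u x| ^ (p - 2) * u x * Real.log |u x| * v x) +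
        ∫ x in Ω, |u x| ^ (p - 2) * u x * v x) 0 := by
  have hN' : (0 : ℝ) < N := by exact_mod_cast hN
  have hp0 : 0 < p := by linarith
  have hκ : 0 < s * p / N * p := by positivity
  have := isFiniteMeasure_restrict_of_isBounded hΩb
  obtain ⟨h1, h2⟩ := hasDerivAt_integral_abs_rpow_mul_log hp hκ
    ((W0.memLp_gagliardoNirenberg hN hs hp0 hu).restrict Ω)
    ((W0.memLp_gagliardoNirenberg hN hs hp0 hv).restrict Ω)
  have h3 := (hasDerivAt_integral_abs_rpow hp (hu.1.restrict Ω) (hv.1.restrict Ω)).1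
  refine h2.congr_deriv ?_
  have h4 : IntegrableOn (fun x => p * (|u x| ^ (p - 2) * u x * Real.log |u x| * v x)) Ω :=
    (h1.sub h3).congr (Eventually.of_forall fun x => by simp only [Pi.sub_apply]; ring)
  rw [← integral_const_mul, ← integral_add h4 h3]
  congr 1 with x
  ring

theorem hasDerivAt_nehariFunctional (hN : 0 < N) (hs : 0 < s) (hp : 2 ≤ p)
    (hΩb : Bornology.IsBounded Ω) {u v : 𝔼 → ℝ} (hu : u ∈ W0 Ω s p) (hv : v ∈ W0 Ω s p) :
    HasDerivAt (fun t : ℝ => nehariFunctional Ω s p (u + t • v))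
      (p * formK N s p u v + p * (∫ x in Ω, |u x| ^ (p - 2) * u x * v x) -
        (p * (∫ x in Ω, |u x| ^ (p - 2) * u x * Real.log |u x| * v x) +
          ∫ x in Ω, |u x| ^ (p - 2) * u x * v x)) 0 :=
  ((hasDerivAt_gagliardoPow hp hu hv).add (hasDerivAt_normPow hp hu hv)).sub
    (hasDerivAt_logTerm hN hs hp hΩb hu hv)

/-- Differentiating the logarithm leaves `-(1/p) ∫|u|^(p-2) u v`, which the term `m/p²` of the
energy cancels. -/
theorem hasDerivAt_energy (hN : 0 < N) (hs : 0 < s) (hp : 2 ≤ p)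
    (hΩb : Bornology.IsBounded Ω) {u v : 𝔼 → ℝ} (hu : u ∈ W0 Ω s p) (hv : v ∈ W0 Ω s p) :
    HasDerivAt (fun t : ℝ => energy Ω s p (u + t • v))
      (formK N s p u v + (∫ x in Ω, |u x| ^ (p - 2) * u x * v x) -
        ∫ x in Ω, |u x| ^ (p - 2) * u x * Real.log |u x| * v x) 0 := by
  have hp0 : p ≠ 0 := by linarith
  simp only [energy_eq]
  refine (((hasDerivAt_nehariFunctional hN hs hp hΩb hu hv).const_mul (1 / p)).add
    ((hasDerivAt_normPow hp hu hv).const_mul (1 / p ^ 2))).congr_deriv ?_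
  field_simp
  ring

/-- A minimizer of the energy on the Nehari manifold is a critical point of the energy. -/
theorem isCriticalPoint_of_forall_le_rayMax (hN : 0 < N) (hs : 0 < s) (hp : 2 ≤ p)
    (hΩ : MeasurableSet Ω) (hΩb : Bornology.IsBounded Ω) {u : 𝔼 → ℝ} (hu : u ∈ nehari Ω s p)
    (hmin : ∀ v ∈ X0 Ω s p, energy Ω s p u ≤ rayMax Ω s p v) : IsCriticalPoint Ω s p u := by
  have hp0 : 0 < p := by linarith
  refine ⟨hu.1.1, fun v hv => ?_⟩
  have hm := normPow_pos hp0 hΩ hu.1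
  have hE := hasDerivAt_energy hN hs hp hΩb hu.1.1 hv
  have hI := hasDerivAt_nehariFunctional hN hs hp hΩb hu.1.1 hv
  have hM := hasDerivAt_normPow (Ω := Ω) hp hu.1.1 hv
  have hu0 : u + (0 : ℝ) • v = u := by simp
  have hX : ∀ᶠ t : ℝ in 𝓝 0, u + t • v ∈ X0 Ω s p := by
    have h1 := hM.continuousAt.eventually (lt_mem_nhds (show 0 < normPow Ω p (u + (0 : ℝ) • v) by
      rwa [hu0]))
    filter_upwards [h1] with t ht
    exact mem_X0_of_normPow_pos hp0 hΩ (W0.add_smul hp0 hu.1.1 hv t) ht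
  have hR := (((hI.div hM (by rw [hu0]; exact hm.ne')).const_mul p).exp.mul hM).const_mul (1 / p ^ 2)
  have hR' : DifferentiableAt ℝ (fun t : ℝ => rayMax Ω s p (u + t • v)) 0 := hR.differentiableAt
  have hray0 : rayMax Ω s p (u + (0 : ℝ) • v) = energy Ω s p u := by
    rw [hu0, rayMax_of_mem_nehari hu]
  -- `rayMax` has a local minimum at `u` along the line, since nearby points remain in `X0`.
  have d1 : deriv (fun t : ℝ => rayMax Ω s p (u + t • v)) 0 = 0 := by
    refine IsLocalMin.deriv_eq_zero (hX.mono fun t ht => ?_)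
    simp only [hray0]
    exact hmin _ ht
  -- The difference is nonnegative on `X0` and vanishes at `u`, so this is a second local minimum.
  have d2 : deriv (fun t : ℝ => rayMax Ω s p (u + t • v) - energy Ω s p (u + t • v)) 0 = 0 := by
    refine IsLocalMin.deriv_eq_zero (hX.mono fun t ht => ?_)
    simp only [hu0, rayMax_of_mem_nehari hu, sub_self]
    exact sub_nonneg.2 (energy_le_rayMax hN hs (by linarith) hΩ hΩb ht)
  have d3 := hR'.hasDerivAt.sub hE.differentiableAt.hasDerivAt
  have d4 := d3.deriv
  rw [d1] at d4
  have d5 : deriv (fun t : ℝ => energy Ω s p (u + t • v)) 0 = 0 := by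
    have := d2.symm.trans d4
    linarith
  have := hE.differentiableAt.hasDerivAt
  rwa [d5] at this

theorem IsCriticalPoint.isStationarySolution (hN : 0 < N) (hs : 0 < s) (hp : 2 ≤ p)
    (hΩb : Bornology.IsBounded Ω) {u : 𝔼 → ℝ} (hu : IsCriticalPoint Ω s p u) :
    IsStationarySolution Ω s p u := by
  refine ⟨hu.1, fun v hv => ?_⟩
  have := (hasDerivAt_energy hN hs hp hΩb hu.1 hv).unique (hu.2 v hv)
  linarith

/-- Testing the equation with `w` itself gives `I(w) = 0`. -/
theorem IsStationarySolution.mem_nehari (hp : 2 ≤ p) {w : 𝔼 → ℝ} (hw : w ∈ X0 Ω s p)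
    (h : IsStationarySolution Ω s p w) : w ∈ nehari Ω s p := by
  have hp0 : p ≠ 0 := by linarith
  refine ⟨hw, ?_⟩
  have h1 := h.2 w hw.1
  have e : ∀ t : ℝ, |t| ^ (p - 2) * t * t = |t| ^ p := fun t => by
    rcases eq_or_ne t 0 with rfl | ht
    · simp [Real.zero_rpow hp0]
    · have ht' : 0 < |t| := abs_pos.2 ht
      rw [mul_assoc, ← abs_mul_abs_self t, ← pow_two, ← Real.rpow_natCast, ← Real.rpow_add ht']
      norm_num
  have e1 : formK N s p w w = (gagliardoPow N s p w).toReal := by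
    have h2 := W0.memLp_diffQuot (by linarith) hw.1
    rw [toReal_gagliardoPow hp0 hw.1.1.1,
      integral_prod _ (MemLp.integrable_abs_rpow (by linarith) h2), formK]
    congr 1 with x
    congr 1 with y
    rw [abs_diffQuot_rpow hp0, ← e]
    ring
  have e2 : ∫ x in Ω, |w x| ^ (p - 2) * w x * w x = normPow Ω p w := by
    simp only [e]; rfl
  have e3 : ∫ x in Ω, |w x| ^ (p - 2) * w x * Real.log |w x| * w x = logTerm Ω p w := by
    rw [logTerm]
    congr 1 with x
    rw [← e]; ring
  rw [e1, e2, e3] at h1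
  rw [nehariFunctional]; linarith

/-! ### Nontriviality of the space -/

/-- In polar coordinates the integrand is `t^(p - 1 - sp)` near zero, integrable because `s < 1`,
and a multiple of `t^(-1 - sp)` at infinity, integrable because `s p > 0`. -/
theorem integrable_min_rpow_div (hN : 0 < N) (hs : 0 < s) (hs1 : s < 1) (hp : 0 < p) {r : ℝ}
    (hr : 0 < r) :
    Integrable fun z : 𝔼 => min ‖z‖ r ^ p / ‖z‖ ^ ((N : ℝ) + s * p) := by
  have : Nonempty (Fin N) := ⟨⟨0, hN⟩⟩
  rw [integrable_fun_norm_addHaar (volume : Measure 𝔼)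
    (f := fun t => min t r ^ p / t ^ ((N : ℝ) + s * p)), finrank_euclideanSpace_fin,
    ← Set.Ioc_union_Ioi_eq_Ioi hr.le]
  have hpow : ∀ t : ℝ, 0 < t → t ^ ((N : ℝ) + s * p) = t ^ (N - 1) * t ^ (1 + s * p) := by
    intro t ht
    rw [← Real.rpow_natCast, ← Real.rpow_add ht, Nat.cast_sub hN]
    congr 1; push_cast; ring
  refine IntegrableOn.union ?_ ?_
  · have h1 : IntegrableOn (fun t : ℝ => t ^ (p - 1 - s * p)) (Set.Ioc 0 r) := by
      rw [integrableOn_Ioc_iff_integrableOn_Ioo, intervalIntegral.integrableOn_Ioo_rpow_iff hr]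
      nlinarith
    refine h1.congr_fun (fun t ht => ?_) measurableSet_Ioc
    have ht0 : 0 < t := ht.1
    simp only [smul_eq_mul]
    rw [min_eq_left ht.2, hpow t ht0, show p - 1 - s * p = p - (1 + s * p) by ring,
      Real.rpow_sub ht0]
    field_simp
  · have h1 : IntegrableOn (fun t : ℝ => r ^ p * t ^ (-(1 + s * p))) (Set.Ioi r) :=
      (integrableOn_Ioi_rpow_of_lt (by nlinarith [mul_pos hs hp]) hr).const_mul _
    refine h1.congr_fun (fun t ht => ?_) measurableSet_Ioi
    have ht0 : 0 < t := hr.trans ht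
    simp only [smul_eq_mul]
    rw [min_eq_right (le_of_lt ht), hpow t ht0, Real.rpow_neg ht0.le]
    field_simp

/-- Bounded Lipschitz functions supported in a ball have finite Gagliardo seminorm. -/
theorem gagliardoPow_lt_top_of_lipschitz (hN : 0 < N) (hs : 0 < s) (hs1 : s < 1) (hp : 0 < p)
    {r : ℝ} (hr : 0 < r) {c : 𝔼} {u : 𝔼 → ℝ} (hlip : ∀ x y, |u x - u y| ≤ min ‖x - y‖ r)
    (hsupp : ∀ x, x ∉ Metric.ball c r → u x = 0) : gagliardoPow N s p u < ⊤ := by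
  set B := Metric.ball c r with hB
  set k : 𝔼 → ENNReal := fun z => ENNReal.ofReal (min ‖z‖ r ^ p / ‖z‖ ^ ((N : ℝ) + s * p)) with hk
  have hkm : Measurable k := by
    refine Measurable.ennreal_ofReal (Measurable.div ?_ ?_) <;> fun_prop
  have hkfin : ∫⁻ z, k z < ⊤ := by
    have h := (integrable_min_rpow_div hN hs hs1 hp hr (N := N)).2
    rwa [hasFiniteIntegral_iff_ofReal (Eventually.of_forall fun z => by positivity)] at h
  -- The numerator vanishes unless `x` or `y` lies in the ball; by translation invariance each
  -- summand integrates to `|B| ∫ k`.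
  have h1 : ∀ x y, ENNReal.ofReal (|u x - u y| ^ p / ‖x - y‖ ^ ((N : ℝ) + s * p)) ≤
      B.indicator 1 x * k (x - y) + B.indicator 1 y * k (x - y) := by
    intro x y
    have h2 : ENNReal.ofReal (|u x - u y| ^ p / ‖x - y‖ ^ ((N : ℝ) + s * p)) ≤ k (x - y) := by
      refine ENNReal.ofReal_le_ofReal ?_
      gcongr
      exact hlip x y
    by_cases hx : x ∈ B
    · refine le_trans h2 (le_add_right ?_)
      simp [hx]
    by_cases hy : y ∈ B
    · refine le_trans h2 (le_add_left ?_)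
      simp [hy]
    · simp [hsupp x hx, hsupp y hy, Real.zero_rpow hp.ne']
  have hind : Measurable (B.indicator (1 : 𝔼 → ENNReal)) :=
    measurable_one.indicator measurableSet_ball
  have hm1 : ∀ x, Measurable fun y => B.indicator (1 : 𝔼 → ENNReal) x * k (x - y) := fun x => by
    fun_prop
  have hA : ∫⁻ x, ∫⁻ y, B.indicator 1 x * k (x - y) = volume B * ∫⁻ z, k z := by
    have : ∀ x, ∫⁻ y, B.indicator 1 x * k (x - y) = B.indicator 1 x * ∫⁻ z, k z := fun x => by
      rw [lintegral_const_mul _ (by fun_prop), lintegral_sub_left_eq_self k x]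
    simp only [this]
    rw [lintegral_mul_const _ hind, lintegral_indicator_one measurableSet_ball]
  have hA' : ∫⁻ x, ∫⁻ y, B.indicator 1 y * k (x - y) = volume B * ∫⁻ z, k z := by
    rw [lintegral_lintegral_swap (by fun_prop)]
    have : ∀ y, ∫⁻ x, B.indicator 1 y * k (x - y) = B.indicator 1 y * ∫⁻ z, k z := fun y => by
      rw [lintegral_const_mul _ (by fun_prop), lintegral_sub_right_eq_self k y]
    simp only [this]
    rw [lintegral_mul_const _ hind, lintegral_indicator_one measurableSet_ball]
  refine lt_of_le_of_lt (lintegral_mono fun x => lintegral_mono fun y => h1 x y) ?_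
  have hadd : ∀ x, ∫⁻ y, (B.indicator 1 x * k (x - y) + B.indicator 1 y * k (x - y)) =
      (∫⁻ y, B.indicator 1 x * k (x - y)) + ∫⁻ y, B.indicator 1 y * k (x - y) :=
    fun x => lintegral_add_left (hm1 x) _
  simp only [hadd]
  have hmA : Measurable fun x => ∫⁻ y, B.indicator (1 : 𝔼 → ENNReal) x * k (x - y) :=
    Measurable.lintegral_prod_right'
      (f := fun z : 𝔼 × 𝔼 => B.indicator (1 : 𝔼 → ENNReal) z.1 * k (z.1 - z.2)) (by fun_prop)
  rw [lintegral_add_left hmA, hA, hA']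
  exact ENNReal.add_lt_top.2 ⟨ENNReal.mul_lt_top measure_ball_lt_top hkfin,
    ENNReal.mul_lt_top measure_ball_lt_top hkfin⟩

theorem X0_nonempty (hN : 0 < N) (hs : 0 < s) (hs1 : s < 1) (hp : 0 < p) (hΩo : IsOpen Ω)
    (hΩn : Ω.Nonempty) : (X0 Ω s p).Nonempty := by
  obtain ⟨c, hc⟩ := hΩn
  obtain ⟨r, hr, hball⟩ := Metric.isOpen_iff.1 hΩo c hc
  -- A tent over a ball contained in `Ω`.
  set u : 𝔼 → ℝ := fun x => max (r - ‖x - c‖) 0 with hu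
  have hcont : Continuous u := by fun_prop
  have hsupp : ∀ x, x ∉ Metric.ball c r → u x = 0 := fun x hx => by
    rw [Metric.mem_ball, not_lt, dist_eq_norm] at hx
    exact max_eq_right (by linarith)
  have hu0 : ∀ x, 0 ≤ u x := fun x => le_max_right _ _
  have hur : ∀ x, u x ≤ r := fun x => max_le (by linarith [norm_nonneg (x - c)]) hr.le
  have hlip : ∀ x y, |u x - u y| ≤ min ‖x - y‖ r := fun x y => by
    refine le_min ?_ (abs_le.2 ⟨by linarith [hu0 x, hur y], by linarith [hu0 y, hur x]⟩)
    refine (abs_max_sub_max_le_abs _ _ _).trans ?_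
    rw [show r - ‖x - c‖ - (r - ‖y - c‖) = ‖y - c‖ - ‖x - c‖ by ring]
    refine (abs_norm_sub_norm_le _ _).trans (le_of_eq ?_)
    rw [sub_sub_sub_cancel_right, norm_sub_rev]
  refine ⟨u, ⟨?_, gagliardoPow_lt_top_of_lipschitz hN hs hs1 hp hr hlip hsupp,
    Eventually.of_forall fun x hx => hsupp x fun h => hx (hball h)⟩, fun h => ?_⟩
  · refine hcont.memLp_of_hasCompactSupport (HasCompactSupport.of_support_subset_isCompact
      (isCompact_closedBall c r) fun x hx => ?_)
    by_contra h
    exact hx (hsupp x fun h' => h (Metric.ball_subset_closedBall h'))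
  · have h1 : u = 0 := (hcont.ae_eq_iff_eq volume continuous_zero).1 h
    have h2 := congrFun h1 c
    simp [hu, hr.not_ge] at h2

end FracLog

/-! ### The main theorem -/

theorem mainTheorem4 (N : ℕ) (s p : ℝ) (hs0 : 0 < s) (hs1 : s < 1) (hp : 2 ≤ p)
    (hN : s * p < (N : ℝ)) (Ω : Set (EuclideanSpace ℝ (Fin N))) (hΩo : IsOpen Ω)
    (hΩb : Bornology.IsBounded Ω) (hΩn : Ω.Nonempty) :
    (FracLog.depth Ω s p
        = ⨅ u ∈ FracLog.X0 Ω s p, ⨆ (l : ℝ) (_ : 0 < l), (FracLog.energy Ω s p (l • u) : EReal)) ∧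
    (∀ ϱ θ γ : ℝ, 0 < ϱ → ϱ < s * p ^ 2 / N →
      1 / (p + ϱ) = (1 - θ) / p + θ / (N * p / (N - s * p)) →
      γ = (1 - θ) * (p + ϱ) / (p - θ * (p + ϱ)) →
      (∃ C : ℝ, FracLog.LogEstimate Ω s p (1 / 2) γ C) ∧
      ∀ C : ℝ, FracLog.LogEstimate Ω s p (1 / 2) γ C →
        0 < FracLog.radius p γ C ^ p / p ^ 2 ∧
        ((FracLog.radius p γ C ^ p / p ^ 2 : ℝ) : EReal) ≤ FracLog.depth Ω s p) ∧
    (∃ u ∈ FracLog.nehari Ω s p, (FracLog.energy Ω s p u : EReal) = FracLog.depth Ω s p ∧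
      FracLog.IsCriticalPoint Ω s p u ∧ FracLog.IsGroundState Ω s p u) := by
  have hp0 : 0 < p := by linarith
  have hp1 : 1 ≤ p := by linarith
  have hN0 : 0 < N := by
    have : (0 : ℝ) < N := lt_trans (by positivity) hN
    exact_mod_cast this
  have hΩ := hΩo.measurableSet
  refine ⟨FracLog.depth_eq_iInf_iSup hN0 hs0 hp1 hΩ hΩb, fun ϱ θ γ h1 h2 h3 h4 => ?_, ?_⟩
  · have hγ := FracLog.one_lt_interpolation_exponent hN hs0 hp0 h1 h2 h3 h4
    exact ⟨FracLog.exists_logEstimate hN0 hs0 hp1 hΩ hΩb hγ,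
      fun C hC => FracLog.le_depth_of_logEstimate hp1 hΩ hγ hC⟩
  · obtain ⟨u, hu, hmin⟩ := FracLog.exists_mem_nehari_forall_le_rayMax hN0 hs0 hp1 hΩ hΩb
      (FracLog.X0_nonempty hN0 hs0 hs1 hp0 hΩo hΩn)
    have hcrit := FracLog.isCriticalPoint_of_forall_le_rayMax hN0 hs0 hp hΩ hΩb hu hmin
    refine ⟨u, hu, FracLog.energy_eq_depth hN0 hs0 hp1 hΩ hΩb hu hmin, hcrit, hu.1,
      hcrit.isStationarySolution hN0 hs0 hp hΩb, fun w hw hsol => ?_⟩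
    -- A nontrivial solution lies on the Nehari manifold, where energy and `rayMax` coincide, so
    -- minimality of `u` applies.
    rw [← FracLog.rayMax_of_mem_nehari (hsol.mem_nehari hp hw)]
    exact hmin w hw
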